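/- Let $\mathbb D$ be the open unit disk in $\mathbb C$, let $dA=\pi^{-1}\,dx\,dy$ be the normalized area measure on $\mathbb D$, and let the Bergman space $L_a^2$ be the space of holomorphic functions $f$ on $\mathbb D$ with $\int_{\mathbb D}|f|^2\,dA<\infty$. For $z,w\in\mathbb D$ let $\rho(z,w)=\left|\frac{w-z}{1-\overline w z}\right|$ be the pseudo-hyperbolic distance, $\beta(z,w)=\tanh^{-1}\rho(z,w)$ the Bergman distance, and $D(w,r)=\{z\in\mathbb D:\beta(w,z)<r\}$. A finite positive Borel measure $\mu$ on $\mathbb D$ is called a reverse Carleson measure for $L_a^2$ if there is a constant $C>0$ such that $\int_{\mathbb D}|f|^2\,d\mu\ge C\int_{\mathbb D}|f|^2\,dA$ for all $f\in L_a^2$. For $R>0$, consider sequences $\{b_k\}_{k=1}^\infty$ in $\mathbb D$ such that $$\mathbb D=\bigcup_{k=1}^\infty D(b_k,R)\qquad\text{and}\qquad \beta(b_k,b_j)\ge \tfrac R2\quad (k\ne j),$$ and put $\mu_0=\sum_{k=1}^\infty(1-|b_k|^2)^2\,\delta_{b_k}$, where $\delta_{b}$ is the unit point mass at $b$. For every $R>0$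 and every such sequence, $\mu_0$ is a finite measure. Moreover, there are absolute constants $R_0>0$ and $R_1>0$ such that: (a) if $0<R<R_0$, then for every such sequence $\mu_0$ is a reverse Carleson measure for $L_a^2$; (b) if $R>R_1$, then for every such sequence $\mu_0$ is not a reverse Carleson measure for $L_a^2$. -/

import Mathlib

open MeasureTheory

namespace Bergman

/-- The open unit disk `𝔻` in the complex plane. -/
def disk : Set ℂ := Metric.ball 0 1

/-- The normalized area measure `dA = π⁻¹ dx dy` on the disk, so that `A(𝔻) = 1`
(a measure on `ℂ` concentrated on `𝔻`). -/
noncomputable def area : Measure ℂ :=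
  ENNReal.ofReal (Real.pi⁻¹) • (volume : Measure ℂ).restrict disk

/-- The Möbius transform `φ_w(z) = (w - z) / (1 - w̄ z)`. -/
noncomputable def mobius (w z : ℂ) : ℂ := (w - z) / (1 - (starRingEnd ℂ) w * z)

/-- The pseudo-hyperbolic distance `ρ(z, w) = |φ_w(z)|`. -/
noncomputable def rho (z w : ℂ) : ℝ := ‖mobius w z‖

/-- The Bergman distance `β(z, w) = tanh⁻¹ ρ(z, w)`. -/
noncomputable def beta (z w : ℂ) : ℝ := Real.artanh (rho z w)

/-- The Bergman disk `D(w, r) = {z ∈ 𝔻 : β(w, z) < r}`. -/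
def bergmanDisk (w : ℂ) (r : ℝ) : Set ℂ := {z ∈ disk | beta w z < r}

/-- Membership in the Bergman space `L_a²`: holomorphic on the disk and square integrable there
(the values of `f` outside the disk are irrelevant). -/
def MemBergman (f : ℂ → ℂ) : Prop := DifferentiableOn ℂ f disk ∧ MemLp f 2 area

/-- `μ` is a reverse Carleson measure for `L_a²`: for some constant `C > 0`,
`∫_𝔻 |f|² dμ ≥ C ∫_𝔻 |f|² dA` for all `f ∈ L_a²` (both sides in `[0, ∞]`). -/
def IsReverseCarleson (μ : Measure ℂ) : Prop :=
  ∃ C : ℝ, 0 < C ∧ ∀ f : ℂ → ℂ, MemBergman f →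
    ENNReal.ofReal C * ∫⁻ z in disk, ‖f z‖ₑ ^ 2 ∂area ≤ ∫⁻ z in disk, ‖f z‖ₑ ^ 2 ∂μ

/-- A sequence in the disk with `𝔻 = ⋃ D(b_k, R)` and `β(b_k, b_j) ≥ R / 2` for `k ≠ j`. -/
structure IsLattice (R : ℝ) (b : ℕ → ℂ) : Prop where
  mem_disk : ∀ k, b k ∈ disk
  cover : disk = ⋃ k, bergmanDisk (b k) R
  separated : ∀ k j, k ≠ j → R / 2 ≤ beta (b k) (b j)

/-- The measure `∑ (1 - |b_k|²)² δ_{b_k}`. -/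
noncomputable def pointMeasure (b : ℕ → ℂ) : Measure ℂ :=
  Measure.sum fun k => ENNReal.ofReal ((1 - ‖b k‖ ^ 2) ^ 2) • Measure.dirac (b k)

end Bergman

/-!
Dense points: on the Euclidean disk `Δ z` centred at `z` of radius `(1 - ‖z‖) / 2`, the
sub-mean-value property and the Schwarz lemma bound the oscillation of `f` between `z` and a point
at distance `ε (1 - ‖z‖)` by a multiple of `ε` times the root mean square of `f` over `Δ z`. Each
point of the unit disk lies that close to some `b k`, and averaging over `Δ z` is bounded on `L¹`,
so `∫ ‖f‖ ^ 2` is at most a multiple of `∑ (1 - ‖b k‖) ^ 2 * ‖f (b k)‖ ^ 2` plus a multiple of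
`ε ^ 2 ∫ ‖f‖ ^ 2`. For small `ε` the last term is absorbed on the left.

Sparse points: a Bergman function that vanishes at every `b k` without being identically zero rules
out the reverse Carleson inequality. It is found by interpolation with a series of normalized kernel
powers centred at the `b k`. Comparing sums over a separated sequence with area integrals and using
the Forelli–Rudin estimate, the interpolation matrix is, after division by its diagonal, the
identity plus an operator on `ℓ^∞` whose norm tends to `0` as the separation tends to `1`; the
contraction principle then solves the system. The series taking a nonzero value at `b 0` and the
value `0` at all other `b k`, multiplied by `z - b 0`, is the required function.
-/

open MeasureTheory Metric Set Filter
open scoped ENNReal ComplexConjugate BoundedContinuousFunction Topology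

namespace Bergman

section PseudohyperbolicGeometry

variable {w z : ℂ} {s t : ℝ}

theorem mem_disk_iff : z ∈ disk ↔ ‖z‖ < 1 := by simp [disk]

theorem isOpen_disk : IsOpen disk := isOpen_ball

theorem measurableSet_disk : MeasurableSet disk := measurableSet_ball

theorem volume_disk_lt_top : volume disk < ∞ := measure_ball_lt_top

theorem one_sub_norm_mul_norm_le (w z : ℂ) : 1 - ‖w‖ * ‖z‖ ≤ ‖1 - conj w * z‖ := by
  simpa using norm_sub_norm_le (1 : ℂ) (conj w * z)

theorem one_sub_norm_le_left (hz : ‖z‖ < 1) : 1 - ‖w‖ ≤ ‖1 - conj w * z‖ := by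
  nlinarith [one_sub_norm_mul_norm_le w z, norm_nonneg w]

theorem one_sub_norm_le_right (hw : ‖w‖ < 1) : 1 - ‖z‖ ≤ ‖1 - conj w * z‖ := by
  nlinarith [one_sub_norm_mul_norm_le w z, norm_nonneg z]

theorem norm_one_sub_conj_mul_pos (hw : ‖w‖ < 1) (hz : ‖z‖ < 1) : 0 < ‖1 - conj w * z‖ :=
  (sub_pos.2 hw).trans_le (one_sub_norm_le_left hz)

theorem norm_one_sub_conj_mul_le (hw : ‖w‖ < 1) :
    ‖1 - conj w * z‖ ≤ 1 - ‖w‖ ^ 2 + ‖w‖ * ‖w - z‖ := by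
  have hdecomp : 1 - conj w * z = ((1 - ‖w‖ ^ 2 : ℝ) : ℂ) + conj w * (w - z) := by
    push_cast
    rw [← Complex.conj_mul']
    ring
  have hsq : 0 ≤ 1 - ‖w‖ ^ 2 := by nlinarith [norm_nonneg w]
  rw [hdecomp]
  refine (norm_add_le _ _).trans_eq ?_
  rw [Complex.norm_of_nonneg hsq, norm_mul, Complex.norm_conj]

theorem norm_one_sub_conj_mul_sq (w z : ℂ) :
    ‖1 - conj w * z‖ ^ 2 = ‖w - z‖ ^ 2 + (1 - ‖w‖ ^ 2) * (1 - ‖z‖ ^ 2) := by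
  simp only [Complex.sq_norm, Complex.normSq_apply, Complex.sub_re, Complex.sub_im, Complex.one_re,
    Complex.one_im, Complex.mul_re, Complex.mul_im, Complex.conj_re, Complex.conj_im]
  ring

theorem rho_eq_div (w z : ℂ) : rho w z = ‖w - z‖ / ‖1 - conj w * z‖ := by
  rw [rho, mobius, norm_div, norm_sub_rev, ← Complex.norm_conj (1 - conj z * w)]
  simp [mul_comm]

theorem rho_comm (w z : ℂ) : rho w z = rho z w := by
  rw [rho_eq_div z w, rho, mobius, norm_div]

theorem rho_mul_norm_one_sub_conj_mul (hw : ‖w‖ < 1) (hz : ‖z‖ < 1) :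
    rho w z * ‖1 - conj w * z‖ = ‖w - z‖ := by
  rw [rho_eq_div, div_mul_cancel₀ _ (norm_one_sub_conj_mul_pos hw hz).ne']

theorem rho_nonneg (w z : ℂ) : 0 ≤ rho w z := norm_nonneg _

theorem one_sub_rho_sq_mul (hw : ‖w‖ < 1) (hz : ‖z‖ < 1) :
    (1 - rho w z ^ 2) * ‖1 - conj w * z‖ ^ 2 = (1 - ‖w‖ ^ 2) * (1 - ‖z‖ ^ 2) := by
  rw [sub_mul, ← mul_pow, rho_mul_norm_one_sub_conj_mul hw hz, norm_one_sub_conj_mul_sq]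
  ring

theorem rho_lt_one (hw : ‖w‖ < 1) (hz : ‖z‖ < 1) : rho w z < 1 := by
  have hpos : 0 < (1 - ‖w‖ ^ 2) * (1 - ‖z‖ ^ 2) := by
    apply mul_pos <;> nlinarith [norm_nonneg w, norm_nonneg z]
  rw [← one_sub_rho_sq_mul hw hz] at hpos
  nlinarith [pos_of_mul_pos_left hpos (sq_nonneg _), rho_nonneg w z]

theorem one_sub_norm_mul_one_sub_norm_le (hw : ‖w‖ < 1) (hz : ‖z‖ < 1) (hs : 0 ≤ s)
    (hsρ : s ≤ rho w z) :
    (1 - ‖w‖) * (1 - ‖z‖) ≤ (1 - s ^ 2) * ‖1 - conj w * z‖ ^ 2 :=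
  calc (1 - ‖w‖) * (1 - ‖z‖) ≤ (1 - ‖w‖ ^ 2) * (1 - ‖z‖ ^ 2) := by
        have hw' := norm_nonneg w
        have hz' := norm_nonneg z
        gcongr <;> nlinarith
    _ = (1 - rho w z ^ 2) * ‖1 - conj w * z‖ ^ 2 := (one_sub_rho_sq_mul hw hz).symm
    _ ≤ (1 - s ^ 2) * ‖1 - conj w * z‖ ^ 2 := by gcongr

theorem mul_one_sub_norm_le_norm_sub (hw : ‖w‖ < 1) (hz : ‖z‖ < 1) (hsρ : s ≤ rho w z) :
    s * (1 - ‖w‖) ≤ ‖w - z‖ :=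
  calc s * (1 - ‖w‖) ≤ rho w z * ‖1 - conj w * z‖ :=
        mul_le_mul hsρ (one_sub_norm_le_left hz) (sub_nonneg.2 hw.le) (rho_nonneg w z)
    _ = ‖w - z‖ := rho_mul_norm_one_sub_conj_mul hw hz

theorem norm_sub_lt_of_rho_lt (hw : ‖w‖ < 1) (hz : ‖z‖ < 1) (ht : t < 1) (hρ : rho w z < t) :
    ‖w - z‖ < 2 * t / (1 - t) * (1 - ‖w‖) := by
  have hlt : ‖w - z‖ < t * ‖1 - conj w * z‖ := by
    rw [← rho_mul_norm_one_sub_conj_mul hw hz]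
    exact mul_lt_mul_of_pos_right hρ (norm_one_sub_conj_mul_pos hw hz)
  have hle : ‖1 - conj w * z‖ ≤ 2 * (1 - ‖w‖) + ‖w - z‖ := by
    nlinarith [norm_one_sub_conj_mul_le (z := z) hw, norm_nonneg w, norm_nonneg (w - z)]
  rw [div_mul_eq_mul_div, lt_div_iff₀ (sub_pos.2 ht)]
  nlinarith [(rho_nonneg w z).trans_lt hρ]

theorem rho_mem_Ioo (hw : ‖w‖ < 1) (hz : ‖z‖ < 1) : rho w z ∈ Ioo (-1 : ℝ) 1 :=
  ⟨neg_one_lt_zero.trans_le (rho_nonneg w z), rho_lt_one hw hz⟩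

theorem rho_lt_of_beta_lt_artanh (hw : ‖w‖ < 1) (hz : ‖z‖ < 1) (ht : t ∈ Ioo (-1 : ℝ) 1)
    (h : beta w z < Real.artanh t) : rho w z < t :=
  (Real.artanh_lt_artanh_iff (rho_mem_Ioo hw hz) ht).1 h

theorem le_rho_of_artanh_le_beta (hw : ‖w‖ < 1) (hz : ‖z‖ < 1) (ht : t ∈ Ioo (-1 : ℝ) 1)
    (h : Real.artanh t ≤ beta w z) : t ≤ rho w z :=
  (Real.artanh_le_artanh_iff ht (rho_mem_Ioo hw hz)).1 h

end PseudohyperbolicGeometry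

/-- A family of points of the disk whose mutual pseudo-hyperbolic distances are at least `s`. -/
structure IsRhoSeparated {ι : Type*} (s : ℝ) (b : ι → ℂ) : Prop where
  norm_lt_one : ∀ k, ‖b k‖ < 1
  le_rho : ∀ k j, k ≠ j → s ≤ rho (b k) (b j)

theorem isRhoSeparated_of_artanh_le_beta {ι : Type*} {b : ι → ℂ} {s : ℝ} (hs : s ∈ Ioo (-1 : ℝ) 1)
    (hb : ∀ k, b k ∈ disk) (h : ∀ k j, k ≠ j → Real.artanh s ≤ beta (b k) (b j)) :
    IsRhoSeparated s b where
  norm_lt_one k := mem_disk_iff.1 (hb k)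
  le_rho k j hkj :=
    le_rho_of_artanh_le_beta (mem_disk_iff.1 (hb k)) (mem_disk_iff.1 (hb j)) hs (h k j hkj)

theorem volume_ball_eq_ofReal (c : ℂ) {r : ℝ} (hr : 0 ≤ r) :
    volume (ball c r) = ENNReal.ofReal (Real.pi * r ^ 2) := by
  rw [Complex.volume_ball, ← ENNReal.ofReal_pow hr, ← NNReal.coe_real_pi,
    ← ENNReal.ofReal_coe_nnreal, ← ENNReal.ofReal_mul (by positivity), mul_comm]

namespace IsRhoSeparated

variable {ι : Type*} {s : ℝ} {b : ι → ℂ}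

theorem pairwise_disjoint_ball (h : IsRhoSeparated s b) :
    Pairwise (Function.onFun Disjoint fun k => ball (b k) (s / 2 * (1 - ‖b k‖))) := by
  intro k j hkj
  apply ball_disjoint_ball
  have hk := mul_one_sub_norm_le_norm_sub (h.norm_lt_one k) (h.norm_lt_one j) (h.le_rho k j hkj)
  have hj := mul_one_sub_norm_le_norm_sub (h.norm_lt_one j) (h.norm_lt_one k)
    (h.le_rho j k hkj.symm)
  rw [dist_eq_norm]
  rw [norm_sub_rev] at hj
  linarith

theorem ball_subset_disk (h : IsRhoSeparated s b) (hs : s ≤ 1) (k : ι) :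
    ball (b k) (s / 2 * (1 - ‖b k‖)) ⊆ disk := by
  refine ball_subset_ball' ?_
  rw [dist_zero_right]
  nlinarith [h.norm_lt_one k]

theorem tsum_one_sub_norm_sq_mul_le [Countable ι] (h : IsRhoSeparated s b) (hs0 : 0 < s)
    (hs : s ≤ 1) {G : ι → ℝ≥0∞} {g : ℂ → ℝ≥0∞}
    (hG : ∀ k, ∀ w ∈ ball (b k) (s / 2 * (1 - ‖b k‖)), G k ≤ g w) :
    ∑' k, ENNReal.ofReal ((1 - ‖b k‖) ^ 2) * G k ≤
      ENNReal.ofReal (4 / (Real.pi * s ^ 2)) * ∫⁻ w in disk, g w := by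
  have hvol : ∀ k, ENNReal.ofReal ((1 - ‖b k‖) ^ 2) = ENNReal.ofReal (4 / (Real.pi * s ^ 2)) *
      volume (ball (b k) (s / 2 * (1 - ‖b k‖))) := fun k => by
    have hk := sub_pos.2 (h.norm_lt_one k)
    rw [volume_ball_eq_ofReal _ (by positivity), ← ENNReal.ofReal_mul (by positivity)]
    congr 1
    field_simp
    ring
  simp only [hvol, mul_assoc]
  rw [ENNReal.tsum_mul_left]
  gcongr
  calc ∑' k, volume (ball (b k) (s / 2 * (1 - ‖b k‖))) * G k
      ≤ ∑' k, ∫⁻ w in ball (b k) (s / 2 * (1 - ‖b k‖)), g w := by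
        gcongr with k
        rw [mul_comm, ← setLIntegral_const]
        exact setLIntegral_mono' measurableSet_ball (hG k)
    _ = ∫⁻ w in ⋃ k, ball (b k) (s / 2 * (1 - ‖b k‖)), g w :=
        (lintegral_iUnion (fun _ => measurableSet_ball) h.pairwise_disjoint_ball g).symm
    _ ≤ ∫⁻ w in disk, g w :=
        lintegral_mono_set (iUnion_subset fun k => h.ball_subset_disk hs k)

end IsRhoSeparated

theorem one_sub_sq_sq_le {x : ℝ} (h0 : 0 ≤ x) (h1 : x ≤ 1) : (1 - x ^ 2) ^ 2 ≤ 4 * (1 - x) ^ 2 :=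
  calc (1 - x ^ 2) ^ 2 = (1 + x) ^ 2 * (1 - x) ^ 2 := by ring
    _ ≤ 4 * (1 - x) ^ 2 := by gcongr; nlinarith

theorem setLIntegral_pointMeasure {b : ℕ → ℂ} (hb : ∀ k, b k ∈ disk) (g : ℂ → ℝ≥0∞) :
    ∫⁻ z in disk, g z ∂pointMeasure b =
      ∑' k, ENNReal.ofReal ((1 - ‖b k‖ ^ 2) ^ 2) * g (b k) := by
  classical
  rw [pointMeasure, Measure.restrict_sum _ measurableSet_disk, lintegral_sum_measure]
  refine tsum_congr fun k => ?_
  rw [Measure.restrict_smul, lintegral_smul_measure, setLIntegral_dirac, if_pos (hb k),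
    smul_eq_mul]

theorem IsRhoSeparated.isFiniteMeasure_pointMeasure {s : ℝ} {b : ℕ → ℂ} (h : IsRhoSeparated s b)
    (hs0 : 0 < s) (hs : s ≤ 1) : IsFiniteMeasure (pointMeasure b) := by
  refine ⟨?_⟩
  simp only [pointMeasure, Measure.sum_apply _ MeasurableSet.univ, Measure.smul_apply,
    measure_univ, smul_eq_mul]
  calc ∑' k, ENNReal.ofReal ((1 - ‖b k‖ ^ 2) ^ 2) * 1
      ≤ ∑' k, ENNReal.ofReal ((1 - ‖b k‖) ^ 2) * 4 := by
        refine ENNReal.tsum_le_tsum fun k => ?_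
        rw [← ENNReal.ofReal_ofNat 4, ← ENNReal.ofReal_mul (sq_nonneg _), mul_one, mul_comm]
        exact ENNReal.ofReal_le_ofReal <| one_sub_sq_sq_le (norm_nonneg _) (h.norm_lt_one k).le
    _ ≤ ENNReal.ofReal (4 / (Real.pi * s ^ 2)) * ∫⁻ _ in disk, 4 :=
        h.tsum_one_sub_norm_sq_mul_le hs0 hs fun _ _ _ => le_rfl
    _ < ∞ := by
        rw [setLIntegral_const]
        exact ENNReal.mul_lt_top ENNReal.ofReal_lt_top
          (ENNReal.mul_lt_top ENNReal.ofNat_lt_top volume_disk_lt_top)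

section PolarCoordinates

variable {c : ℂ} {r R : ℝ}

theorem lintegral_eq_lintegral_circleMap {g : ℂ → ℝ≥0∞} (hg : Measurable g) (c : ℂ) :
    ∫⁻ z, g z = ∫⁻ r in Ioi 0, ENNReal.ofReal r *
      ∫⁻ θ in Ioo (-Real.pi) Real.pi, g (circleMap c r θ) := by
  have hpolar : ∀ p : ℝ × ℝ, c + Complex.polarCoord.symm p = circleMap c p.1 p.2 := fun p => by
    rw [Complex.polarCoord_symm_apply, circleMap, Complex.exp_mul_I, Complex.ofReal_cos,
      Complex.ofReal_sin]
  have hcirc : Continuous fun p : ℝ × ℝ => circleMap c p.1 p.2 := by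
    simp only [circleMap]
    fun_prop
  rw [← lintegral_add_left_eq_self (μ := (volume : Measure ℂ)) g c,
    ← Complex.lintegral_comp_polarCoord_symm, polarCoord_target, Measure.volume_eq_prod]
  simp only [hpolar, smul_eq_mul]
  rw [setLIntegral_prod]
  · refine lintegral_congr fun r => ?_
    rw [lintegral_const_mul' _ _ ENNReal.ofReal_ne_top]
  · exact ((ENNReal.measurable_ofReal.comp measurable_fst).mul
      (hg.comp hcirc.measurable)).aemeasurable

theorem lintegral_angle_eq_circleAverage {h : ℂ → ℝ} (h0 : ∀ z ∈ sphere c |r|, 0 ≤ h z)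
    (hc : ContinuousOn h (sphere c |r|)) :
    ∫⁻ θ in Ioo (-Real.pi) Real.pi, ENNReal.ofReal (h (circleMap c r θ)) =
      ENNReal.ofReal (2 * Real.pi * Real.circleAverage h c r) := by
  have hcont : Continuous fun θ => h (circleMap c r θ) :=
    hc.comp_continuous (continuous_circleMap c r) (circleMap_mem_sphere' c r)
  have hint : IntegrableOn (fun θ => h (circleMap c r θ)) (Ioo (-Real.pi) Real.pi) :=
    hcont.integrableOn_Icc.mono_set Ioo_subset_Icc_self
  rw [← ofReal_integral_eq_lintegral_ofReal hint
      (Eventually.of_forall fun θ => h0 _ (circleMap_mem_sphere' c r θ)),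
    ← integral_Ioc_eq_integral_Ioo, Real.circleAverage_eq_integral_add (-Real.pi), smul_eq_mul,
    mul_inv_cancel_left₀ Real.two_pi_pos.ne',
    intervalIntegral.integral_comp_add_right (fun θ => h (circleMap c r θ)),
    ← intervalIntegral.integral_of_le (by linarith [Real.pi_pos])]
  congr 2 <;> ring

theorem lintegral_ball_eq_lintegral_circleAverage {h : ℂ → ℝ} (h0 : ∀ z ∈ ball c R, 0 ≤ h z)
    (hc : ContinuousOn h (ball c R)) :
    ∫⁻ z in ball c R, ENNReal.ofReal (h z) =
      ∫⁻ r in Ioo 0 R, ENNReal.ofReal (2 * Real.pi * r * Real.circleAverage h c r) := by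
  have hmeas : Measurable ((ball c R).indicator fun z => ENNReal.ofReal (h z)) := by
    classical
    rw [← piecewise_eq_indicator]
    exact (ENNReal.continuous_ofReal.comp_continuousOn hc).measurable_piecewise continuousOn_const
      measurableSet_ball
  rw [← lintegral_indicator measurableSet_ball, lintegral_eq_lintegral_circleMap hmeas c,
    ← Ioi_inter_Iio (a := (0 : ℝ)), inter_comm (Ioi (0 : ℝ)),
    ← setLIntegral_indicator measurableSet_Iio]
  refine setLIntegral_congr_fun measurableSet_Ioi fun r (hr : 0 < r) => ?_
  have hmem : ∀ θ, circleMap c r θ ∈ ball c R ↔ r < R := fun θ => by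
    rw [mem_ball, dist_eq_norm, circleMap_sub_center, norm_circleMap_zero, abs_of_pos hr]
  by_cases hrR : r < R
  · have hsub : sphere c |r| ⊆ ball c R := by
      rw [abs_of_pos hr]
      exact sphere_subset_ball hrR
    simp only [indicator_of_mem ((hmem _).2 hrR), indicator_of_mem (mem_Iio.2 hrR)]
    rw [lintegral_angle_eq_circleAverage (fun z hz => h0 z (hsub hz)) (hc.mono hsub),
      ← ENNReal.ofReal_mul hr.le]
    congr 1
    ring
  · simp only [indicator_of_notMem (fun hθ => hrR ((hmem _).1 hθ)), lintegral_zero, mul_zero,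
      indicator_of_notMem (show r ∉ Iio R from hrR)]

end PolarCoordinates

section SubMeanValue

variable {E : Type*} [NormedAddCommGroup E] [NormedSpace ℂ E] [CompleteSpace E] {f : ℂ → E} {c : ℂ}
  {r R : ℝ}

theorem norm_le_circleAverage_norm (hf : DiffContOnCl ℂ f (ball c |r|)) :
    ‖f c‖ ≤ Real.circleAverage (fun z => ‖f z‖) c r := by
  rw [← hf.circleAverage, Real.circleAverage_def, Real.circleAverage_def, norm_smul, smul_eq_mul,
    Real.norm_of_nonneg (by positivity)]
  gcongr
  exact intervalIntegral.norm_integral_le_integral_norm Real.two_pi_pos.le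

theorem volume_ball_mul_enorm_le (hf : DifferentiableOn ℂ f (ball c R)) :
    volume (ball c R) * ‖f c‖ₑ ≤ ∫⁻ z in ball c R, ‖f z‖ₑ := by
  calc volume (ball c R) * ‖f c‖ₑ
      = ∫⁻ _ in ball c R, ENNReal.ofReal ‖f c‖ := by rw [setLIntegral_const, mul_comm, ofReal_norm]
    _ = ∫⁻ r in Ioo 0 R, ENNReal.ofReal (2 * Real.pi * r *
          Real.circleAverage (fun _ => ‖f c‖) c r) :=
        lintegral_ball_eq_lintegral_circleAverage (fun _ _ => norm_nonneg _) continuousOn_const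
    _ ≤ ∫⁻ r in Ioo 0 R, ENNReal.ofReal (2 * Real.pi * r *
          Real.circleAverage (fun z => ‖f z‖) c r) := by
        refine setLIntegral_mono' measurableSet_Ioo fun r hr => ENNReal.ofReal_le_ofReal ?_
        have hr0 : 0 < r := hr.1
        have hdiff : DiffContOnCl ℂ f (ball c |r|) := by
          refine DifferentiableOn.diffContOnCl ?_
          rw [abs_of_pos hr0, closure_ball _ hr0.ne']
          exact hf.mono (closedBall_subset_ball hr.2)
        rw [Real.circleAverage_const]
        gcongr
        exact norm_le_circleAverage_norm hdiff
    _ = ∫⁻ z in ball c R, ‖f z‖ₑ := by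
        rw [← lintegral_ball_eq_lintegral_circleAverage (fun _ _ => norm_nonneg _)
          hf.continuousOn.norm]
        simp only [ofReal_norm]

end SubMeanValue

section Oscillation

variable {f : ℂ → ℂ} {c z : ℂ} {r : ℝ}

theorem enorm_sq_le_setLAverage (hr : 0 < r) (hf : DifferentiableOn ℂ f (ball c r)) :
    ‖f c‖ₑ ^ 2 ≤ ⨍⁻ w in ball c r, ‖f w‖ₑ ^ 2 ∂volume := by
  rw [setLAverage_eq, ENNReal.le_div_iff_mul_le (Or.inl (measure_ball_pos _ _ hr).ne')
    (Or.inl measure_ball_lt_top.ne), mul_comm]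
  simpa only [Pi.pow_apply, enorm_pow] using volume_ball_mul_enorm_le (hf.pow 2)

theorem setLAverage_ball_half_le {g : ℂ → ℝ≥0∞} (hz : z ∈ ball c (r / 2)) :
    ⨍⁻ w in ball z (r / 2), g w ∂volume ≤ 4 * ⨍⁻ w in ball c r, g w ∂volume := by
  have hr : 0 < r := by linarith [dist_nonneg.trans_lt hz]
  have hsub : ball z (r / 2) ⊆ ball c r := ball_subset_ball' (by linarith [mem_ball.1 hz])
  have hvol : volume (ball c r) = 4 * volume (ball z (r / 2)) := by
    rw [volume_ball_eq_ofReal _ hr.le, volume_ball_eq_ofReal _ (by positivity),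
      ← ENNReal.ofReal_ofNat 4, ← ENNReal.ofReal_mul (by norm_num)]
    congr 1
    ring
  rw [setLAverage_eq, setLAverage_eq, hvol, ← mul_div_assoc,
    ENNReal.mul_div_mul_left _ _ (by norm_num) ENNReal.ofNat_ne_top]
  gcongr

theorem norm_sub_le_of_forall_norm_le {M : ℝ} (hf : DifferentiableOn ℂ f (ball c r))
    (hM : ∀ w ∈ ball c r, ‖f w‖ ≤ M) (hz : z ∈ ball c r) :
    ‖f z - f c‖ ≤ 2 * M / r * ‖z - c‖ := by
  simp only [← dist_eq_norm]
  refine Complex.dist_le_div_mul_dist_of_mapsTo_ball hf (fun w hw => ?_) hz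
  have hc := hM c (mem_ball_self (dist_nonneg.trans_lt hz))
  rw [mem_closedBall, dist_eq_norm]
  linarith [norm_sub_le (f w) (f c), hM w hw]

theorem enorm_sub_sq_le_setLAverage (hf : DifferentiableOn ℂ f (ball c r))
    (hz : z ∈ ball c (r / 2)) :
    ‖f z - f c‖ₑ ^ 2 ≤
      ENNReal.ofReal (64 * (‖z - c‖ / r) ^ 2) * ⨍⁻ w in ball c r, ‖f w‖ₑ ^ 2 ∂volume := by
  have hr : 0 < r := by linarith [dist_nonneg.trans_lt hz]
  rcases eq_or_ne z c with rfl | hzc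
  · simp
  have hpos : 0 < ‖z - c‖ := norm_pos_iff.2 (sub_ne_zero.2 hzc)
  rcases eq_or_ne (⨍⁻ w in ball c r, ‖f w‖ₑ ^ 2 ∂volume) ∞ with htop | htop
  · rw [htop, ENNReal.mul_top (ENNReal.ofReal_pos.2 (by positivity)).ne']
    exact le_top
  set A := (⨍⁻ w in ball c r, ‖f w‖ₑ ^ 2 ∂volume).toReal with hA
  have hbound : ∀ w ∈ ball c (r / 2), ‖f w‖ ≤ √(4 * A) := fun w hw => by
    have hsub : ball w (r / 2) ⊆ ball c r := ball_subset_ball' (by linarith [mem_ball.1 hw])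
    have hle := (enorm_sq_le_setLAverage (half_pos hr) (hf.mono hsub)).trans
      (setLAverage_ball_half_le hw)
    have htoReal := ENNReal.toReal_mono (ENNReal.mul_ne_top ENNReal.ofNat_ne_top htop) hle
    rw [ENNReal.toReal_pow, toReal_enorm, ENNReal.toReal_mul, ENNReal.toReal_ofNat] at htoReal
    exact Real.le_sqrt_of_sq_le htoReal
  have hschwarz :=
    norm_sub_le_of_forall_norm_le (hf.mono (ball_subset_ball (by linarith))) hbound hz
  rw [← ENNReal.ofReal_toReal htop, ← hA, ← ENNReal.ofReal_mul (by positivity), ← ofReal_norm,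
    ← ENNReal.ofReal_pow (norm_nonneg _)]
  apply ENNReal.ofReal_le_ofReal
  calc ‖f z - f c‖ ^ 2 ≤ (2 * √(4 * A) / (r / 2) * ‖z - c‖) ^ 2 := by gcongr
    _ = 64 * (‖z - c‖ / r) ^ 2 * A := by
        rw [mul_pow, div_pow, mul_pow, Real.sq_sqrt (by positivity)]
        field_simp
        ring

end Oscillation

section LocalAverages

/-- The density at `w` of the averaging operator over the Euclidean disk centred at `z` whose radius
is half the distance from `z` to the unit circle; such disks are comparable to Bergman disks. -/
noncomputable def averagingKernel (z w : ℂ) : ℝ≥0∞ :=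
  (ball z ((1 - ‖z‖) / 2)).indicator (fun _ => (volume (ball z ((1 - ‖z‖) / 2)))⁻¹) w

theorem measurable_averagingKernel : Measurable (Function.uncurry averagingKernel) := by
  have hset : MeasurableSet {p : ℂ × ℂ | dist p.2 p.1 < (1 - ‖p.1‖) / 2} :=
    measurableSet_lt (by fun_prop) (by fun_prop)
  have hvol : Measurable fun p : ℂ × ℂ => (volume (ball p.1 ((1 - ‖p.1‖) / 2)))⁻¹ := by
    simp only [Complex.volume_ball]
    fun_prop
  exact hvol.indicator hset

theorem ball_half_subset_disk (z : ℂ) : ball z ((1 - ‖z‖) / 2) ⊆ disk := by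
  rcases lt_or_ge ‖z‖ 1 with hz | hz
  · exact ball_subset_ball' (by rw [dist_zero_right]; linarith)
  · rw [ball_eq_empty.2 (by linarith)]
    exact empty_subset _

theorem setLAverage_eq_lintegral_averagingKernel (g : ℂ → ℝ≥0∞) (z : ℂ) :
    ⨍⁻ w in ball z ((1 - ‖z‖) / 2), g w ∂volume = ∫⁻ w in disk, averagingKernel z w * g w := by
  rcases lt_or_ge ‖z‖ 1 with hz | hz
  · have hvol : (volume (ball z ((1 - ‖z‖) / 2)))⁻¹ ≠ ∞ :=
      ENNReal.inv_ne_top.2 (measure_ball_pos _ _ (by linarith)).ne'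
    simp only [averagingKernel, ← indicator_mul_left]
    rw [setLIntegral_indicator measurableSet_ball, inter_eq_self_of_subset_left
      (ball_half_subset_disk z), lintegral_const_mul' _ _ hvol, setLAverage_eq, div_eq_mul_inv,
      mul_comm]
  · have hempty : ball z ((1 - ‖z‖) / 2) = ∅ := ball_eq_empty.2 (by linarith)
    simp [averagingKernel, hempty]

theorem averagingKernel_le {w z : ℂ} (hw : ‖w‖ < 1) (hz : ‖z‖ < 1) :
    averagingKernel z w ≤
      (ball w (1 - ‖w‖)).indicator (fun _ => 9 * (volume (ball w (1 - ‖w‖)))⁻¹) z := by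
  have hw0 : 0 < 1 - ‖w‖ := sub_pos.2 hw
  by_cases hwz : w ∈ ball z ((1 - ‖z‖) / 2)
  · have hlt : ‖w - z‖ < (1 - ‖z‖) / 2 := by rwa [← dist_eq_norm]
    have hzw : z ∈ ball w (1 - ‖w‖) := by
      rw [mem_ball, dist_comm, dist_eq_norm]
      linarith [norm_sub_norm_le w z]
    have hradii : 1 - ‖w‖ ≤ 3 * ((1 - ‖z‖) / 2) := by
      linarith [norm_sub_norm_le z w, norm_sub_rev z w]
    have hareas : Real.pi * (1 - ‖w‖) ^ 2 ≤ Real.pi * ((1 - ‖z‖) / 2) ^ 2 * 9 :=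
      calc Real.pi * (1 - ‖w‖) ^ 2 ≤ Real.pi * (3 * ((1 - ‖z‖) / 2)) ^ 2 := by gcongr
        _ = Real.pi * ((1 - ‖z‖) / 2) ^ 2 * 9 := by ring
    rw [averagingKernel, indicator_of_mem hwz, indicator_of_mem hzw,
      volume_ball_eq_ofReal _ hw0.le, volume_ball_eq_ofReal _ (by positivity),
      ← ENNReal.ofReal_inv_of_pos (by positivity), ← ENNReal.ofReal_inv_of_pos (by positivity),
      ← ENNReal.ofReal_ofNat 9, ← ENNReal.ofReal_mul (by positivity)]
    apply ENNReal.ofReal_le_ofReal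
    rwa [← div_eq_mul_inv, inv_le_comm₀ (by positivity) (by positivity), inv_div,
      div_le_iff₀ (by norm_num)]
  · rw [averagingKernel, indicator_of_notMem hwz]
    exact zero_le

theorem lintegral_averagingKernel_le {w : ℂ} (hw : ‖w‖ < 1) :
    ∫⁻ z in disk, averagingKernel z w ≤ 9 := by
  have hw0 : 0 < 1 - ‖w‖ := sub_pos.2 hw
  calc ∫⁻ z in disk, averagingKernel z w
      ≤ ∫⁻ z in disk, (ball w (1 - ‖w‖)).indicator
          (fun _ => 9 * (volume (ball w (1 - ‖w‖)))⁻¹) z :=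
        setLIntegral_mono' measurableSet_disk fun z hz => averagingKernel_le hw (mem_disk_iff.1 hz)
    _ ≤ 9 * ((volume (ball w (1 - ‖w‖)))⁻¹ * volume (ball w (1 - ‖w‖))) := by
        rw [← mul_assoc]
        exact (setLIntegral_le_lintegral _ _).trans_eq
          (lintegral_indicator_const measurableSet_ball _)
    _ = 9 := by
        rw [ENNReal.inv_mul_cancel (measure_ball_pos _ _ hw0).ne' measure_ball_lt_top.ne, mul_one]

theorem setLIntegral_setLAverage_le {g : ℂ → ℝ≥0∞} (hg : AEMeasurable g (volume.restrict disk)) :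
    ∫⁻ z in disk, ⨍⁻ w in ball z ((1 - ‖z‖) / 2), g w ∂volume ≤ 9 * ∫⁻ w in disk, g w := by
  calc ∫⁻ z in disk, ⨍⁻ w in ball z ((1 - ‖z‖) / 2), g w ∂volume
      = ∫⁻ z in disk, ∫⁻ w in disk, averagingKernel z w * g w := by
        simp only [setLAverage_eq_lintegral_averagingKernel]
    _ = ∫⁻ w in disk, ∫⁻ z in disk, averagingKernel z w * g w :=
        lintegral_lintegral_swap (measurable_averagingKernel.aemeasurable.mul hg.comp_snd)
    _ ≤ ∫⁻ w in disk, 9 * g w := by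
        refine setLIntegral_mono' measurableSet_disk fun w hw => ?_
        have hmeas : Measurable fun z => averagingKernel z w :=
          measurable_averagingKernel.comp measurable_prodMk_right
        rw [lintegral_mul_const _ hmeas]
        gcongr
        exact lintegral_averagingKernel_le (mem_disk_iff.1 hw)
    _ = 9 * ∫⁻ w in disk, g w := lintegral_const_mul' _ _ ENNReal.ofNat_ne_top

end LocalAverages

section Sampling

variable {f : ℂ → ℂ} {ε : ℝ}

theorem enorm_sq_le_two_mul_add_enorm_sub_sq {E : Type*} [SeminormedAddCommGroup E] (x y : E) :
    ‖x‖ₑ ^ 2 ≤ 2 * (‖y‖ₑ ^ 2 + ‖x - y‖ₑ ^ 2) := by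
  have h : ‖x‖₊ ≤ ‖y‖₊ + ‖x - y‖₊ := by simpa using nnnorm_add_le y (x - y)
  simp only [enorm_eq_nnnorm]
  exact_mod_cast (pow_le_pow_left' h 2).trans add_sq_le

theorem enorm_sq_le_two_mul_add_setLAverage {c z : ℂ} (hf : DifferentiableOn ℂ f disk)
    (hz : ‖z‖ < 1) (hε : ε ≤ 1 / 4) (hc : ‖c - z‖ < ε * (1 - ‖z‖)) :
    ‖f z‖ₑ ^ 2 ≤ 2 * (‖f c‖ₑ ^ 2 + ENNReal.ofReal (256 * ε ^ 2) *
      ⨍⁻ w in ball z ((1 - ‖z‖) / 2), ‖f w‖ₑ ^ 2 ∂volume) := by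
  have hmem : c ∈ ball z ((1 - ‖z‖) / 2 / 2) := by
    rw [mem_ball, dist_eq_norm]
    nlinarith
  have hratio : ‖c - z‖ / ((1 - ‖z‖) / 2) ≤ 2 * ε := by
    rw [div_le_iff₀ (by positivity)]
    linarith
  refine (enorm_sq_le_two_mul_add_enorm_sub_sq (f z) (f c)).trans ?_
  rw [← enorm_neg (f z - f c), neg_sub]
  gcongr
  refine (enorm_sub_sq_le_setLAverage (hf.mono (ball_half_subset_disk z)) hmem).trans ?_
  refine mul_le_mul_left (ENNReal.ofReal_le_ofReal ?_) _
  calc 64 * (‖c - z‖ / ((1 - ‖z‖) / 2)) ^ 2 ≤ 64 * (2 * ε) ^ 2 := by gcongr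
    _ = 256 * ε ^ 2 := by ring

theorem setLIntegral_tsum_indicator_ball_le {ι : Type*} [Countable ι] {b : ι → ℂ} (hε0 : 0 ≤ ε)
    (hb : ∀ k, b k ∈ disk) (a : ι → ℝ≥0∞) :
    ∫⁻ z in disk, ∑' k, (ball (b k) (ε * (1 - ‖b k‖))).indicator (fun _ => a k) z ≤
      ENNReal.ofReal (Real.pi * ε ^ 2) * ∑' k, ENNReal.ofReal ((1 - ‖b k‖) ^ 2) * a k := by
  rw [lintegral_tsum fun k => (measurable_const.indicator measurableSet_ball).aemeasurable,
    ← ENNReal.tsum_mul_left]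
  gcongr with k
  have hk : 0 ≤ 1 - ‖b k‖ := sub_nonneg.2 (mem_disk_iff.1 (hb k)).le
  refine (setLIntegral_le_lintegral _ _).trans_eq ?_
  rw [lintegral_indicator_const measurableSet_ball, volume_ball_eq_ofReal _ (by positivity),
    ← mul_assoc, ← ENNReal.ofReal_mul (by positivity), mul_comm]
  congr 2
  ring

theorem setLIntegral_enorm_sq_le_tsum {ι : Type*} [Countable ι] {b : ι → ℂ} (hε0 : 0 ≤ ε)
    (hε : ε ≤ 1 / 4) (hb : ∀ k, b k ∈ disk) (hf : DifferentiableOn ℂ f disk)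
    (hcover : ∀ z ∈ disk, ∃ k, ‖z - b k‖ < ε * (1 - ‖b k‖) ∧ ‖b k - z‖ < ε * (1 - ‖z‖)) :
    ∫⁻ z in disk, ‖f z‖ₑ ^ 2 ≤
      2 * (ENNReal.ofReal (Real.pi * ε ^ 2) *
          (∑' k, ENNReal.ofReal ((1 - ‖b k‖) ^ 2) * ‖f (b k)‖ₑ ^ 2) +
        ENNReal.ofReal (256 * ε ^ 2) * (9 * ∫⁻ z in disk, ‖f z‖ₑ ^ 2)) := by
  have hmeas : AEMeasurable (fun z => ‖f z‖ₑ ^ 2) (volume.restrict disk) :=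
    (hf.continuousOn.enorm.aemeasurable measurableSet_disk).pow_const 2
  set samples : ℂ → ℝ≥0∞ := fun z =>
    ∑' k, (ball (b k) (ε * (1 - ‖b k‖))).indicator (fun _ => ‖f (b k)‖ₑ ^ 2) z
  have hsamples_meas : Measurable samples :=
    Measurable.tsum fun k => measurable_const.indicator measurableSet_ball
  have hpointwise : ∀ z ∈ disk, ‖f z‖ₑ ^ 2 ≤ 2 * (samples z + ENNReal.ofReal (256 * ε ^ 2) *
      ⨍⁻ w in ball z ((1 - ‖z‖) / 2), ‖f w‖ₑ ^ 2 ∂volume) := fun z hz => by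
    obtain ⟨k, hzk, hkz⟩ := hcover z hz
    have hk : ‖f (b k)‖ₑ ^ 2 ≤ samples z := by
      refine le_of_eq_of_le ?_ (ENNReal.le_tsum k)
      rw [indicator_of_mem (by rwa [mem_ball, dist_eq_norm])]
    refine (enorm_sq_le_two_mul_add_setLAverage hf (mem_disk_iff.1 hz) hε hkz).trans ?_
    gcongr
  calc ∫⁻ z in disk, ‖f z‖ₑ ^ 2
      ≤ 2 * ((∫⁻ z in disk, samples z) + ENNReal.ofReal (256 * ε ^ 2) *
          ∫⁻ z in disk, ⨍⁻ w in ball z ((1 - ‖z‖) / 2), ‖f w‖ₑ ^ 2 ∂volume) := by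
        rw [← lintegral_const_mul' _ _ ENNReal.ofReal_ne_top, ← lintegral_add_left hsamples_meas,
          ← lintegral_const_mul' _ _ ENNReal.ofNat_ne_top]
        exact setLIntegral_mono' measurableSet_disk hpointwise
    _ ≤ 2 * (ENNReal.ofReal (Real.pi * ε ^ 2) *
          (∑' k, ENNReal.ofReal ((1 - ‖b k‖) ^ 2) * ‖f (b k)‖ₑ ^ 2) +
          ENNReal.ofReal (256 * ε ^ 2) * (9 * ∫⁻ z in disk, ‖f z‖ₑ ^ 2)) := by
        gcongr
        · exact setLIntegral_tsum_indicator_ball_le hε0 hb _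
        · exact setLIntegral_setLAverage_le hmeas

theorem le_two_mul_of_le_add_half {x y : ℝ≥0∞} (hx : x ≠ ∞) (h : x ≤ y + x / 2) : x ≤ 2 * y := by
  have hhalf : x / 2 ≤ y := by
    refine ENNReal.le_of_add_le_add_right (a := x / 2) (ENNReal.div_ne_top hx two_ne_zero) ?_
    rwa [ENNReal.add_halves]
  rwa [mul_comm, ← ENNReal.div_le_iff two_ne_zero ENNReal.ofNat_ne_top]

end Sampling

section ReverseCarleson

variable {f : ℂ → ℂ} {b : ℕ → ℂ}

theorem setLIntegral_area (g : ℂ → ℝ≥0∞) :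
    ∫⁻ z in disk, g z ∂area = ENNReal.ofReal Real.pi⁻¹ * ∫⁻ z in disk, g z := by
  rw [area, Measure.restrict_smul, lintegral_smul_measure,
    Measure.restrict_restrict measurableSet_disk, inter_self, smul_eq_mul]

theorem memBergman_iff : MemBergman f ↔
    DifferentiableOn ℂ f disk ∧ ∫⁻ z in disk, ‖f z‖ₑ ^ 2 < ∞ := by
  refine and_congr_right fun hf => ?_
  have hpi : ENNReal.ofReal Real.pi⁻¹ ≠ 0 := (ENNReal.ofReal_pos.2 (by positivity)).ne'
  have hmeas : AEStronglyMeasurable f area :=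
    (hf.continuousOn.aestronglyMeasurable measurableSet_disk).smul_measure _
  rw [MemLp, and_iff_right hmeas, eLpNorm_lt_top_iff_lintegral_rpow_enorm_lt_top two_ne_zero
    ENNReal.ofNat_ne_top, area, lintegral_smul_measure, smul_eq_mul]
  simp only [ENNReal.toReal_ofNat, ENNReal.rpow_ofNat]
  exact ⟨fun h => ENNReal.lt_top_of_mul_ne_top_right h.ne hpi,
    ENNReal.mul_lt_top ENNReal.ofReal_lt_top⟩

theorem isReverseCarleson_pointMeasure_of_norm_sub_lt (hb : ∀ k, b k ∈ disk)
    (hcover : ∀ z ∈ disk, ∃ k, ‖z - b k‖ < 1 / 96 * (1 - ‖b k‖) ∧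
      ‖b k - z‖ < 1 / 96 * (1 - ‖z‖)) : IsReverseCarleson (pointMeasure b) := by
  refine ⟨2304, by norm_num, fun f hf => ?_⟩
  obtain ⟨hholo, hfin⟩ := memBergman_iff.1 hf
  have hsample := setLIntegral_enorm_sq_le_tsum (by norm_num) (by norm_num) hb hholo hcover
  have hhalf : 2 * (ENNReal.ofReal (256 * (1 / 96) ^ 2) * 9) = 2⁻¹ := by
    rw [← ENNReal.ofReal_ofNat 2, ← ENNReal.ofReal_ofNat 9, ← ENNReal.ofReal_mul (by norm_num),
      ← ENNReal.ofReal_mul (by norm_num), ← ENNReal.ofReal_inv_of_pos two_pos]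
    norm_num
  rw [mul_add, ← mul_assoc, ← mul_assoc _ 9, ← mul_assoc 2 (_ * 9), hhalf, mul_comm 2⁻¹,
    ← div_eq_mul_inv] at hsample
  have hbound := le_two_mul_of_le_add_half hfin.ne hsample
  rw [setLIntegral_area, setLIntegral_pointMeasure hb]
  calc ENNReal.ofReal 2304 * (ENNReal.ofReal Real.pi⁻¹ * ∫⁻ z in disk, ‖f z‖ₑ ^ 2)
      ≤ ENNReal.ofReal 2304 * (ENNReal.ofReal Real.pi⁻¹ *
          (2 * (2 * ENNReal.ofReal (Real.pi * (1 / 96) ^ 2) *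
            ∑' k, ENNReal.ofReal ((1 - ‖b k‖) ^ 2) * ‖f (b k)‖ₑ ^ 2))) := by gcongr
    _ = ∑' k, ENNReal.ofReal ((1 - ‖b k‖) ^ 2) * ‖f (b k)‖ₑ ^ 2 := by
        rw [← ENNReal.ofReal_ofNat 2]
        simp only [← mul_assoc]
        rw [← ENNReal.ofReal_mul (by positivity), ← ENNReal.ofReal_mul (by positivity),
          ← ENNReal.ofReal_mul (by positivity), ← ENNReal.ofReal_mul (by positivity)]
        have hone : 2304 * Real.pi⁻¹ * 2 * 2 * (Real.pi * (1 / 96) ^ 2) = 1 := by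
          field_simp
          norm_num
        rw [hone, ENNReal.ofReal_one, one_mul]
    _ ≤ ∑' k, ENNReal.ofReal ((1 - ‖b k‖ ^ 2) ^ 2) * ‖f (b k)‖ₑ ^ 2 := by
        gcongr with k
        · exact sub_nonneg.2 (mem_disk_iff.1 (hb k)).le
        · exact pow_le_of_le_one (norm_nonneg _) (mem_disk_iff.1 (hb k)).le two_ne_zero

theorem isReverseCarleson_pointMeasure_of_rho_lt (hb : ∀ k, b k ∈ disk)
    (hcover : ∀ z ∈ disk, ∃ k, rho (b k) z < 1 / 193) : IsReverseCarleson (pointMeasure b) := by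
  refine isReverseCarleson_pointMeasure_of_norm_sub_lt hb fun z hz => ?_
  obtain ⟨k, hk⟩ := hcover z hz
  have hz' := mem_disk_iff.1 hz
  have hk' := mem_disk_iff.1 (hb k)
  have hconst : (2 * (1 / 193) / (1 - 1 / 193) : ℝ) = 1 / 96 := by norm_num
  refine ⟨k, ?_, ?_⟩ <;> rw [norm_sub_rev, ← hconst]
  · exact norm_sub_lt_of_rho_lt hk' hz' (by norm_num) hk
  · exact norm_sub_lt_of_rho_lt hz' hk' (by norm_num) (rho_comm _ _ ▸ hk)

end ReverseCarleson

section ForelliRudin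

variable {γ : ℝ}

theorem circleAverage_inv_norm_one_sub_conj_mul_sq {r : ℝ} {z : ℂ} (hr : 0 < r)
    (hrz : r * ‖z‖ < 1) :
    Real.circleAverage (fun w => (‖1 - conj w * z‖ ^ 2)⁻¹) 0 r = (1 - (r * ‖z‖) ^ 2)⁻¹ := by
  have hpos : 0 < 1 - (r * ‖z‖) ^ 2 := by nlinarith [mul_nonneg hr.le (norm_nonneg z)]
  have hball : (r ^ 2 : ℂ) * z ∈ ball (0 : ℂ) r := by
    rw [mem_ball_zero_iff, norm_mul, norm_pow, Complex.norm_of_nonneg hr.le]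
    nlinarith
  have hpoisson := InnerProductSpace.HarmonicOnNhd.circleAverage_poissonKernel_smul
    (f := fun _ => (1 : ℝ)) (c := 0) (R := r) (InnerProductSpace.harmonicOnNhd_const _) hball
  have hkernel : ∀ w ∈ sphere (0 : ℂ) |r|, (‖1 - conj w * z‖ ^ 2)⁻¹ =
      (1 - (r * ‖z‖) ^ 2)⁻¹ • (poissonKernel 0 (r ^ 2 * z) • fun _ => (1 : ℝ)) w := by
    intro w hw
    rw [abs_of_pos hr, mem_sphere_zero_iff_norm] at hw
    have hfactor : w - r ^ 2 * z = w * (1 - conj w * z) := by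
      rw [← hw, ← Complex.mul_conj']
      ring
    have hquot : poissonKernel 0 (r ^ 2 * z) w =
        (1 - (r * ‖z‖) ^ 2) * (‖1 - conj w * z‖ ^ 2)⁻¹ := by
      simp only [poissonKernel, sub_zero, hfactor, norm_mul, norm_pow, hw,
        Complex.norm_of_nonneg hr.le]
      field_simp
    simp only [Pi.smul_apply', smul_eq_mul, mul_one, hquot, inv_mul_cancel_left₀ hpos.ne']
  rw [Real.circleAverage_congr_sphere hkernel, Real.circleAverage_fun_smul, hpoisson, smul_eq_mul,
    mul_one]

theorem lintegral_Ioc_rpow_neg {y : ℝ} (h1 : γ < 1) (hy : 0 < y) :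
    ∫⁻ u in Ioc 0 y, ENNReal.ofReal (u ^ (-γ)) = ENNReal.ofReal (y ^ (1 - γ) / (1 - γ)) := by
  have hint : IntervalIntegrable (fun u : ℝ => u ^ (-γ)) volume 0 y :=
    intervalIntegral.intervalIntegrable_rpow' (by linarith)
  rw [intervalIntegrable_iff_integrableOn_Ioc_of_le hy.le] at hint
  rw [← ofReal_integral_eq_lintegral_ofReal hint
      ((ae_restrict_mem measurableSet_Ioc).mono fun u hu => Real.rpow_nonneg hu.1.le _),
    ← intervalIntegral.integral_of_le hy.le, integral_rpow (Or.inl (by linarith)),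
    neg_add_eq_sub, Real.zero_rpow (by linarith), sub_zero]

theorem lintegral_Ioi_rpow_neg_sub_one {y : ℝ} (h0 : 0 < γ) (hy : 0 < y) :
    ∫⁻ u in Ioi y, ENNReal.ofReal (u ^ (-γ - 1)) = ENNReal.ofReal (y ^ (-γ) / γ) := by
  rw [← ofReal_integral_eq_lintegral_ofReal (integrableOn_Ioi_rpow_of_lt (by linarith) hy)
      ((ae_restrict_mem measurableSet_Ioi).mono fun u hu => Real.rpow_nonneg (hy.trans hu).le _),
    integral_Ioi_rpow_of_lt (by linarith) hy, sub_add_cancel, neg_div_neg_eq]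

theorem lintegral_Ioi_rpow_neg_div_max {y : ℝ} (h0 : 0 < γ) (h1 : γ < 1) (hy : 0 < y) :
    ∫⁻ u in Ioi 0, ENNReal.ofReal (u ^ (-γ) / max u y) =
      ENNReal.ofReal ((1 / (1 - γ) + 1 / γ) * y ^ (-γ)) := by
  have hnear : ∫⁻ u in Ioc 0 y, ENNReal.ofReal (u ^ (-γ) / max u y) =
      ENNReal.ofReal (1 / (1 - γ) * y ^ (-γ)) := by
    have hcongr : ∀ u ∈ Ioc 0 y, ENNReal.ofReal (u ^ (-γ) / max u y) =
        ENNReal.ofReal y⁻¹ * ENNReal.ofReal (u ^ (-γ)) := fun u hu => by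
      rw [max_eq_right hu.2, ← ENNReal.ofReal_mul (by positivity), div_eq_inv_mul]
    rw [setLIntegral_congr_fun measurableSet_Ioc hcongr,
      lintegral_const_mul' _ _ ENNReal.ofReal_ne_top, lintegral_Ioc_rpow_neg h1 hy,
      ← ENNReal.ofReal_mul (by positivity), sub_eq_neg_add 1 γ, Real.rpow_add_one hy.ne']
    congr 1
    field_simp
  have hfar : ∫⁻ u in Ioi y, ENNReal.ofReal (u ^ (-γ) / max u y) =
      ENNReal.ofReal (1 / γ * y ^ (-γ)) := by
    have hcongr : ∀ u ∈ Ioi y, ENNReal.ofReal (u ^ (-γ) / max u y) =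
        ENNReal.ofReal (u ^ (-γ - 1)) := fun u hu => by
      rw [max_eq_left (mem_Ioi.1 hu).le, Real.rpow_sub_one (hy.trans hu).ne']
    rw [setLIntegral_congr_fun measurableSet_Ioi hcongr, lintegral_Ioi_rpow_neg_sub_one h0 hy,
      div_eq_inv_mul, one_div]
  rw [← Ioc_union_Ioi_eq_Ioi hy.le, lintegral_union measurableSet_Ioi Ioc_disjoint_Ioi_same,
    hnear, hfar, ← ENNReal.ofReal_add (by positivity) (by positivity), add_mul]

/-- The kernel `(1 - ‖w‖) ^ (-γ) / ‖1 - conj w * z‖ ^ 2`, whose integral over `w` in the unit disk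
is at most a constant times `(1 - ‖z‖) ^ (-γ)` when `0 < γ < 1`. -/
noncomputable def forelliRudinKernel (γ : ℝ) (w z : ℂ) : ℝ :=
  (1 - ‖w‖) ^ (-γ) / ‖1 - conj w * z‖ ^ 2

/-- The constant for which the Forelli–Rudin estimate for `forelliRudinKernel γ` is proved. -/
noncomputable def forelliRudinConst (γ : ℝ) : ℝ := 2 * Real.pi * (1 / (1 - γ) + 1 / γ)

theorem forelliRudinConst_pos (h0 : 0 < γ) (h1 : γ < 1) : 0 < forelliRudinConst γ := by
  unfold forelliRudinConst
  positivity

theorem forelliRudinKernel_nonneg {w : ℂ} (hw : ‖w‖ < 1) (z : ℂ) :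
    0 ≤ forelliRudinKernel γ w z :=
  div_nonneg (Real.rpow_nonneg (sub_pos.2 hw).le _) (sq_nonneg _)

theorem continuousOn_forelliRudinKernel {z : ℂ} (hz : ‖z‖ < 1) :
    ContinuousOn (fun w => forelliRudinKernel γ w z) disk := by
  refine ContinuousOn.div ?_ (by fun_prop) fun w hw =>
    (pow_pos (norm_one_sub_conj_mul_pos (mem_disk_iff.1 hw) hz) 2).ne'
  exact ContinuousOn.rpow_const (by fun_prop) fun w hw =>
    Or.inl (sub_pos.2 (mem_disk_iff.1 hw)).ne'

theorem circleAverage_forelliRudinKernel {r : ℝ} {z : ℂ} (hr : 0 < r) (hrz : r * ‖z‖ < 1) :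
    Real.circleAverage (fun w => forelliRudinKernel γ w z) 0 r =
      (1 - r) ^ (-γ) / (1 - (r * ‖z‖) ^ 2) := by
  rw [div_eq_mul_inv, ← circleAverage_inv_norm_one_sub_conj_mul_sq hr hrz, ← smul_eq_mul,
    ← Real.circleAverage_fun_smul]
  refine Real.circleAverage_congr_sphere fun w hw => ?_
  rw [abs_of_pos hr, mem_sphere_zero_iff_norm] at hw
  rw [forelliRudinKernel, hw, smul_eq_mul, div_eq_mul_inv]

theorem max_one_sub_le_one_sub_mul_sq {x y : ℝ} (hx0 : 0 ≤ x) (hx1 : x ≤ 1) (hy0 : 0 ≤ y)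
    (hy1 : y ≤ 1) : max (1 - x) (1 - y) ≤ 1 - (x * y) ^ 2 := by
  have hxy : (x * y) ^ 2 ≤ x * y := pow_le_of_le_one (by positivity) (by nlinarith) two_ne_zero
  refine max_le ?_ ?_ <;> nlinarith

theorem lintegral_forelliRudinKernel_le (h0 : 0 < γ) (h1 : γ < 1) {z : ℂ} (hz : ‖z‖ < 1) :
    ∫⁻ w in disk, ENNReal.ofReal (forelliRudinKernel γ w z) ≤
      ENNReal.ofReal (forelliRudinConst γ * (1 - ‖z‖) ^ (-γ)) := by
  have hz' : 0 < 1 - ‖z‖ := sub_pos.2 hz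
  have hradial : ∀ r ∈ Ioo (0 : ℝ) 1,
      2 * Real.pi * r * Real.circleAverage (fun w => forelliRudinKernel γ w z) 0 r ≤
        2 * Real.pi * ((1 - r) ^ (-γ) / max (1 - r) (1 - ‖z‖)) := fun r ⟨hr0, hr1⟩ => by
    have hpow : 0 ≤ (1 - r) ^ (-γ) := Real.rpow_nonneg (sub_pos.2 hr1).le _
    have hmax := max_one_sub_le_one_sub_mul_sq hr0.le hr1.le (norm_nonneg z) hz.le
    have hmax0 : 0 < max (1 - r) (1 - ‖z‖) := lt_max_of_lt_right hz'
    rw [circleAverage_forelliRudinKernel hr0 (by nlinarith [norm_nonneg z]), mul_assoc]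
    gcongr 2 * Real.pi * ?_
    exact (mul_le_of_le_one_left (div_nonneg hpow (hmax0.le.trans hmax)) hr1.le).trans (by gcongr)
  calc ∫⁻ w in disk, ENNReal.ofReal (forelliRudinKernel γ w z)
      = ∫⁻ r in Ioo 0 1, ENNReal.ofReal
          (2 * Real.pi * r * Real.circleAverage (fun w => forelliRudinKernel γ w z) 0 r) :=
        lintegral_ball_eq_lintegral_circleAverage
          (fun w hw => forelliRudinKernel_nonneg (mem_disk_iff.1 hw) z)
          (continuousOn_forelliRudinKernel hz)
    _ ≤ ∫⁻ r in Ioo 0 1, ENNReal.ofReal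
          (2 * Real.pi * ((1 - r) ^ (-γ) / max (1 - r) (1 - ‖z‖))) :=
        setLIntegral_mono' measurableSet_Ioo fun r hr => ENNReal.ofReal_le_ofReal (hradial r hr)
    _ = ∫⁻ u in Ioo 0 1, ENNReal.ofReal (2 * Real.pi * (u ^ (-γ) / max u (1 - ‖z‖))) := by
        have hsub :=
          (Measure.measurePreserving_sub_left volume (1 : ℝ)).setLIntegral_comp_preimage_emb
            (Homeomorph.subLeft (1 : ℝ)).measurableEmbedding
            (fun u => ENNReal.ofReal (2 * Real.pi * (u ^ (-γ) / max u (1 - ‖z‖)))) (Ioo 0 1)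
        rwa [preimage_const_sub_Ioo, sub_self, sub_zero] at hsub
    _ ≤ ∫⁻ u in Ioi 0, ENNReal.ofReal (2 * Real.pi * (u ^ (-γ) / max u (1 - ‖z‖))) :=
        lintegral_mono_set Ioo_subset_Ioi_self
    _ = ENNReal.ofReal (forelliRudinConst γ * (1 - ‖z‖) ^ (-γ)) := by
        simp only [ENNReal.ofReal_mul Real.two_pi_pos.le]
        rw [lintegral_const_mul' _ _ ENNReal.ofReal_ne_top,
          lintegral_Ioi_rpow_neg_div_max h0 h1 hz', ← ENNReal.ofReal_mul Real.two_pi_pos.le,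
          ← mul_assoc, forelliRudinConst]

theorem rpow_neg_le_two_mul_rpow_neg {x y : ℝ} (h0 : 0 ≤ γ) (h1 : γ ≤ 1) (hx : 0 < x) (hy : 0 < y)
    (hxy : y ≤ 2 * x) : x ^ (-γ) ≤ 2 * y ^ (-γ) :=
  calc x ^ (-γ) = 2 ^ γ * (2 * x) ^ (-γ) := by
        rw [Real.mul_rpow zero_le_two hx.le, Real.rpow_neg zero_le_two,
          mul_inv_cancel_left₀ (Real.rpow_pos_of_pos two_pos γ).ne']
    _ ≤ 2 * y ^ (-γ) := by
        gcongr ?_ * ?_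
        · simpa only [Real.rpow_one] using Real.rpow_le_rpow_of_exponent_le one_le_two h1
        · exact Real.rpow_le_rpow_of_nonpos hy hxy (neg_nonpos.2 h0)

theorem forelliRudinKernel_le_of_norm_sub_le (h0 : 0 ≤ γ) (h1 : γ ≤ 1) {b w z : ℂ} (hb : ‖b‖ < 1)
    (hz : ‖z‖ < 1) (hw : ‖w - b‖ ≤ 1 / 2 * (1 - ‖b‖)) :
    forelliRudinKernel γ b z ≤ 9 / 2 * forelliRudinKernel γ w z := by
  have hwb : ‖w‖ ≤ ‖b‖ + ‖w - b‖ := norm_le_norm_add_norm_sub' w b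
  have hbw : ‖b‖ ≤ ‖w‖ + ‖w - b‖ := norm_le_norm_add_norm_sub w b
  have hw1 : ‖w‖ < 1 := by linarith
  have hnum : (1 - ‖b‖) ^ (-γ) ≤ 2 * (1 - ‖w‖) ^ (-γ) :=
    rpow_neg_le_two_mul_rpow_neg h0 h1 (sub_pos.2 hb) (sub_pos.2 hw1) (by linarith)
  have hden : ‖1 - conj w * z‖ ≤ 3 / 2 * ‖1 - conj b * z‖ :=
    calc ‖1 - conj w * z‖ = ‖(1 - conj b * z) - conj (w - b) * z‖ := by
          rw [map_sub]
          ring_nf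
      _ ≤ ‖1 - conj b * z‖ + ‖conj (w - b) * z‖ := norm_sub_le _ _
      _ ≤ ‖1 - conj b * z‖ + ‖w - b‖ := by
          rw [norm_mul, Complex.norm_conj]
          gcongr
          exact mul_le_of_le_one_right (norm_nonneg _) hz.le
      _ ≤ 3 / 2 * ‖1 - conj b * z‖ := by linarith [one_sub_norm_le_left (w := b) hz]
  have hpos := norm_one_sub_conj_mul_pos hw1 hz
  calc forelliRudinKernel γ b z
      ≤ 2 * (1 - ‖w‖) ^ (-γ) / (2 / 3 * ‖1 - conj w * z‖) ^ 2 := by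
        unfold forelliRudinKernel
        gcongr
        linarith
    _ = 9 / 2 * forelliRudinKernel γ w z := by
        unfold forelliRudinKernel
        field_simp
        norm_num

theorem IsRhoSeparated.tsum_forelliRudinKernel_le {ι : Type*} [Countable ι] {s : ℝ} {b : ι → ℂ}
    (h : IsRhoSeparated s b) (hs0 : 0 < s) (hs : s ≤ 1) (h0 : 0 < γ) (h1 : γ < 1) {z : ℂ}
    (hz : ‖z‖ < 1) :
    ∑' k, ENNReal.ofReal ((1 - ‖b k‖) ^ 2 * forelliRudinKernel γ (b k) z) ≤
      ENNReal.ofReal (6 * forelliRudinConst γ / s ^ 2 * (1 - ‖z‖) ^ (-γ)) := by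
  have hcompare : ∀ k, ∀ w ∈ ball (b k) (s / 2 * (1 - ‖b k‖)),
      ENNReal.ofReal (forelliRudinKernel γ (b k) z) ≤
        ENNReal.ofReal (9 / 2) * ENNReal.ofReal (forelliRudinKernel γ w z) := fun k w hw => by
    have hk := h.norm_lt_one k
    rw [← ENNReal.ofReal_mul (by norm_num)]
    refine ENNReal.ofReal_le_ofReal
      (forelliRudinKernel_le_of_norm_sub_le h0.le h1.le hk hz ?_)
    rw [mem_ball, dist_eq_norm] at hw
    nlinarith
  have hconst : 4 / (Real.pi * s ^ 2) * (9 / 2) ≤ 6 / s ^ 2 := by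
    rw [div_mul_eq_mul_div, div_le_div_iff₀ (by positivity) (by positivity)]
    nlinarith [Real.pi_gt_three, sq_pos_of_pos hs0]
  calc ∑' k, ENNReal.ofReal ((1 - ‖b k‖) ^ 2 * forelliRudinKernel γ (b k) z)
      = ∑' k, ENNReal.ofReal ((1 - ‖b k‖) ^ 2) *
          ENNReal.ofReal (forelliRudinKernel γ (b k) z) :=
        tsum_congr fun k => ENNReal.ofReal_mul (sq_nonneg _)
    _ ≤ ENNReal.ofReal (4 / (Real.pi * s ^ 2)) * ∫⁻ w in disk,
          ENNReal.ofReal (9 / 2) * ENNReal.ofReal (forelliRudinKernel γ w z) :=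
        h.tsum_one_sub_norm_sq_mul_le hs0 hs hcompare
    _ ≤ ENNReal.ofReal (4 / (Real.pi * s ^ 2)) * (ENNReal.ofReal (9 / 2) *
          ENNReal.ofReal (forelliRudinConst γ * (1 - ‖z‖) ^ (-γ))) := by
        rw [lintegral_const_mul' _ _ ENNReal.ofReal_ne_top]
        gcongr
        exact lintegral_forelliRudinKernel_le h0 h1 hz
    _ ≤ ENNReal.ofReal (6 * forelliRudinConst γ / s ^ 2 * (1 - ‖z‖) ^ (-γ)) := by
        have hC := forelliRudinConst_pos h0 h1
        rw [← mul_assoc, ← ENNReal.ofReal_mul (by positivity), ← ENNReal.ofReal_mul (by positivity),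
          mul_div_right_comm, mul_assoc (6 / s ^ 2)]
        gcongr

theorem summable_and_tsum_le_of_tsum_ofReal_le {ι : Type*} {a : ι → ℝ} {C : ℝ} (ha : ∀ k, 0 ≤ a k)
    (hC : 0 ≤ C) (h : ∑' k, ENNReal.ofReal (a k) ≤ ENNReal.ofReal C) :
    Summable a ∧ ∑' k, a k ≤ C := by
  have hs : Summable a := by
    simpa only [ENNReal.toReal_ofReal (ha _)] using
      ENNReal.summable_toReal (ne_top_of_le_ne_top ENNReal.ofReal_ne_top h)
  refine ⟨hs, ?_⟩
  rwa [← ENNReal.ofReal_tsum_of_nonneg ha hs, ENNReal.ofReal_le_ofReal_iff hC] at h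

theorem IsRhoSeparated.summable_and_tsum_forelliRudinKernel_le {ι : Type*} [Countable ι] {s : ℝ}
    {b : ι → ℂ} (h : IsRhoSeparated s b) (hs0 : 0 < s) (hs : s ≤ 1) (h0 : 0 < γ) (h1 : γ < 1)
    {z : ℂ} (hz : ‖z‖ < 1) :
    (Summable fun k => (1 - ‖b k‖) ^ 2 * forelliRudinKernel γ (b k) z) ∧
      ∑' k, (1 - ‖b k‖) ^ 2 * forelliRudinKernel γ (b k) z ≤
        6 * forelliRudinConst γ / s ^ 2 * (1 - ‖z‖) ^ (-γ) := by
  have hC := forelliRudinConst_pos h0 h1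
  exact summable_and_tsum_le_of_tsum_ofReal_le
    (fun k => mul_nonneg (sq_nonneg _) (forelliRudinKernel_nonneg (h.norm_lt_one k) z))
    (by positivity) (h.tsum_forelliRudinKernel_le hs0 hs h0 h1 hz)

theorem forelliRudinKernel_zero_right (γ : ℝ) (w : ℂ) :
    forelliRudinKernel γ w 0 = (1 - ‖w‖) ^ (-γ) := by
  simp [forelliRudinKernel]

theorem forelliRudinKernel_le_of_norm_le {w z : ℂ} {r : ℝ} (hw : ‖w‖ < 1) (hr : r < 1)
    (hz : ‖z‖ ≤ r) : forelliRudinKernel γ w z ≤ ((1 - r) ^ 2)⁻¹ * forelliRudinKernel γ w 0 := by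
  rw [forelliRudinKernel_zero_right, ← div_eq_inv_mul, forelliRudinKernel]
  gcongr
  linarith [one_sub_norm_le_right (z := z) hw]

end ForelliRudin

section Interpolation

section BoundedCoefficients

variable {ι 𝕜 : Type*} [NormedField 𝕜] {M : ℝ}

theorem summable_norm_mul_of_norm_le {a e : ι → 𝕜} (ha : Summable fun k => ‖a k‖)
    (he : ∀ k, ‖e k‖ ≤ M) : Summable fun k => ‖a k * e k‖ :=
  (ha.mul_right M).of_nonneg_of_le (fun _ => norm_nonneg _) fun k => by
    rw [norm_mul]
    gcongr
    exact he k

theorem norm_tsum_mul_le {a e : ι → 𝕜} (ha : Summable fun k => ‖a k‖) (he : ∀ k, ‖e k‖ ≤ M) :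
    ‖∑' k, a k * e k‖ ≤ (∑' k, ‖a k‖) * M :=
  calc ‖∑' k, a k * e k‖ ≤ ∑' k, ‖a k * e k‖ :=
        norm_tsum_le_tsum_norm (summable_norm_mul_of_norm_le ha he)
    _ ≤ ∑' k, ‖a k‖ * M := by
        refine (summable_norm_mul_of_norm_le ha he).tsum_le_tsum (fun k => ?_) (ha.mul_right M)
        rw [norm_mul]
        gcongr
        exact he k
    _ = (∑' k, ‖a k‖) * M := tsum_mul_right

theorem exists_bounded_add_tsum_mul_eq [CompleteSpace 𝕜] {B : ι → ι → 𝕜} {θ : ℝ} (hθ : θ < 1)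
    (hB : ∀ j, Summable fun k => ‖B j k‖) (hBθ : ∀ j, ∑' k, ‖B j k‖ ≤ θ) {v : ι → 𝕜}
    (hv : ∀ j, ‖v j‖ ≤ M) :
    ∃ e : ι → 𝕜, (∃ M', ∀ j, ‖e j‖ ≤ M') ∧ ∀ j, e j + ∑' k, B j k * e k = v j := by
  let _ : TopologicalSpace ι := ⊥
  have : DiscreteTopology ι := ⟨rfl⟩
  have hbound : ∀ (e : ι →ᵇ 𝕜) j, ‖∑' k, B j k * e k‖ ≤ θ * ‖e‖ := fun e j =>
    (norm_tsum_mul_le (hB j) e.norm_coe_le_norm).trans (by gcongr; exact hBθ j)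
  let T : (ι →ᵇ 𝕜) → (ι →ᵇ 𝕜) := fun e =>
    .ofNormedAddCommGroupDiscrete v M hv -
      .ofNormedAddCommGroupDiscrete (fun j => ∑' k, B j k * e k) (θ * ‖e‖) (hbound e)
  have hT : ∀ e j, T e j = v j - ∑' k, B j k * e k := fun _ _ => rfl
  have hcontr : ContractingWith θ.toNNReal T := by
    refine ⟨Real.toNNReal_lt_one.2 hθ, LipschitzWith.of_dist_le_mul fun e e' => ?_⟩
    rw [BoundedContinuousFunction.dist_le (by positivity)]
    intro j
    have hsum : ∀ e : ι →ᵇ 𝕜, Summable fun k => B j k * e k := fun e =>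
      (summable_norm_mul_of_norm_le (hB j) e.norm_coe_le_norm).of_norm
    have hdiff : T e j - T e' j = ∑' k, B j k * (e' - e) k := by
      simp only [hT, sub_sub_sub_cancel_left, ← (hsum e').tsum_sub (hsum e),
        BoundedContinuousFunction.coe_sub, Pi.sub_apply, mul_sub]
    rw [dist_eq_norm, hdiff, dist_comm, dist_eq_norm]
    exact (hbound _ _).trans (by gcongr; exact Real.le_coe_toNNReal θ)
  obtain ⟨e, he⟩ : ∃ e, T e = e := ⟨_, hcontr.fixedPoint_isFixedPt⟩
  refine ⟨e, ⟨‖e‖, e.norm_coe_le_norm⟩, fun j => ?_⟩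
  have hej : e j = v j - ∑' k, B j k * e k := by rw [← hT, he]
  exact eq_sub_iff_add_eq.1 hej

end BoundedCoefficients

/-- The interpolating functions centred at `b`: the weight `(1 - ‖b‖) ^ (-γ)`, which allows bounded
coefficients in `kernelSeries`, times the cube of the kernel `(1 - ‖b‖ ^ 2) / (1 - conj b * z)`
normalized to be `1` at `z = b`. -/
noncomputable def kernelAtom (γ : ℝ) (b z : ℂ) : ℂ :=
  ((1 - ‖b‖) ^ (-γ) : ℝ) * (((1 - ‖b‖ ^ 2 : ℝ) : ℂ) / (1 - conj b * z)) ^ 3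

variable {γ s : ℝ} {z : ℂ}

theorem kernelAtom_self {b : ℂ} (hb : ‖b‖ < 1) : kernelAtom γ b b = ((1 - ‖b‖) ^ (-γ) : ℝ) := by
  have hconj : ((1 - ‖b‖ ^ 2 : ℝ) : ℂ) = 1 - conj b * b := by
    rw [Complex.conj_mul']
    push_cast
    rfl
  rw [kernelAtom, hconj, div_self (norm_pos_iff.1 (norm_one_sub_conj_mul_pos hb hb)), one_pow,
    mul_one]

theorem differentiableOn_kernelAtom {b : ℂ} (hb : ‖b‖ < 1) :
    DifferentiableOn ℂ (kernelAtom γ b) disk := by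
  refine DifferentiableOn.const_mul (DifferentiableOn.pow ?_ 3) _
  exact DifferentiableOn.div (by fun_prop) (by fun_prop) fun z hz =>
    norm_pos_iff.1 (norm_one_sub_conj_mul_pos hb (mem_disk_iff.1 hz))

theorem norm_kernelAtom_le {b : ℂ} (hb : ‖b‖ < 1) :
    ‖kernelAtom γ b z‖ ≤ 8 * ((1 - ‖b‖) ^ (-γ) * ((1 - ‖b‖) / ‖1 - conj b * z‖) ^ 3) := by
  have hb' : 0 < 1 - ‖b‖ := sub_pos.2 hb
  have hb0 := norm_nonneg b
  have hsq : 0 ≤ 1 - ‖b‖ ^ 2 := by nlinarith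
  have hpow : 0 ≤ (1 - ‖b‖) ^ (-γ) := Real.rpow_nonneg hb'.le _
  calc ‖kernelAtom γ b z‖
      = (1 - ‖b‖) ^ (-γ) * ((1 - ‖b‖ ^ 2) / ‖1 - conj b * z‖) ^ 3 := by
        rw [kernelAtom, norm_mul, norm_pow, norm_div, Complex.norm_of_nonneg hpow,
          Complex.norm_of_nonneg hsq]
    _ ≤ (1 - ‖b‖) ^ (-γ) * (2 * (1 - ‖b‖) / ‖1 - conj b * z‖) ^ 3 := by
        gcongr
        nlinarith
    _ = 8 * ((1 - ‖b‖) ^ (-γ) * ((1 - ‖b‖) / ‖1 - conj b * z‖) ^ 3) := by ring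

theorem norm_kernelAtom_le_forelliRudinKernel {b : ℂ} (hb : ‖b‖ < 1) (hz : ‖z‖ < 1) :
    ‖kernelAtom γ b z‖ ≤ 8 * ((1 - ‖b‖) ^ 2 * forelliRudinKernel γ b z) := by
  have hratio : (1 - ‖b‖) / ‖1 - conj b * z‖ ≤ 1 :=
    (div_le_one (norm_one_sub_conj_mul_pos hb hz)).2 (one_sub_norm_le_left hz)
  calc ‖kernelAtom γ b z‖
      ≤ 8 * ((1 - ‖b‖) ^ (-γ) * ((1 - ‖b‖) / ‖1 - conj b * z‖) ^ 3) := norm_kernelAtom_le hb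
    _ ≤ 8 * ((1 - ‖b‖) ^ (-γ) * ((1 - ‖b‖) / ‖1 - conj b * z‖) ^ 2) := by
        gcongr 8 * (_ * ?_)
        exact pow_le_pow_of_le_one (by positivity) hratio (by norm_num)
    _ = 8 * ((1 - ‖b‖) ^ 2 * forelliRudinKernel γ b z) := by
        rw [forelliRudinKernel]
        ring

theorem rpow_neg_mul_div_le {d e D η : ℝ} (h0 : 0 ≤ γ) (h1 : γ ≤ 1) (hd : 0 < d) (he : 0 < e)
    (hη : 0 ≤ η) (hdD : d ≤ D) (h : d * e ≤ η * D ^ 2) :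
    d ^ (-γ) * (d / D) ≤ η ^ (γ / 2) * e ^ (-(γ / 2)) * d ^ (-(γ / 2)) := by
  have hD : 0 < D := hd.trans_le hdD
  have hsq : (d / D) ^ 2 ≤ η * (d / e) := by
    rw [div_pow, ← mul_div_assoc, div_le_div_iff₀ (by positivity) he]
    nlinarith
  have hpow : d / D ≤ (η * (d / e)) ^ (γ / 2) :=
    calc d / D ≤ (d / D) ^ γ :=
          Real.self_le_rpow_of_le_one (by positivity) ((div_le_one hD).2 hdD) h1
      _ = ((d / D) ^ 2) ^ (γ / 2) := by
          rw [← Real.rpow_natCast_mul (by positivity)]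
          congr 1
          push_cast
          ring
      _ ≤ (η * (d / e)) ^ (γ / 2) := by gcongr
  calc d ^ (-γ) * (d / D) ≤ d ^ (-γ) * (η * (d / e)) ^ (γ / 2) := by gcongr
    _ = η ^ (γ / 2) * e ^ (-(γ / 2)) * (d ^ (-γ) * d ^ (γ / 2)) := by
        rw [Real.mul_rpow hη (by positivity), Real.div_rpow hd.le he.le, Real.rpow_neg he.le]
        ring
    _ = η ^ (γ / 2) * e ^ (-(γ / 2)) * d ^ (-(γ / 2)) := by
        rw [← Real.rpow_add hd]
        congr 2
        ring

-- Only one of the three kernel factors is spent on the separation; the other two are kept for the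
-- Forelli–Rudin estimate with exponent `γ / 2`.
theorem norm_kernelAtom_le_of_le_rho {b : ℂ} (hb : ‖b‖ < 1) (hz : ‖z‖ < 1) (hs0 : 0 ≤ s)
    (hs : s ≤ 1) (hbz : s ≤ rho b z) (h0 : 0 ≤ γ) (h1 : γ ≤ 1) :
    ‖kernelAtom γ b z‖ ≤ 8 * ((1 - s ^ 2) ^ (γ / 2) * (1 - ‖z‖) ^ (-(γ / 2))) *
      ((1 - ‖b‖) ^ 2 * forelliRudinKernel (γ / 2) b z) := by
  have hweight := rpow_neg_mul_div_le h0 h1 (sub_pos.2 hb) (sub_pos.2 hz)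
    (show 0 ≤ 1 - s ^ 2 by nlinarith) (one_sub_norm_le_left hz)
    (one_sub_norm_mul_one_sub_norm_le hb hz hs0 hbz)
  calc ‖kernelAtom γ b z‖
      ≤ 8 * ((1 - ‖b‖) ^ (-γ) * ((1 - ‖b‖) / ‖1 - conj b * z‖) ^ 3) := norm_kernelAtom_le hb
    _ = 8 * ((1 - ‖b‖) ^ (-γ) * ((1 - ‖b‖) / ‖1 - conj b * z‖)) *
          ((1 - ‖b‖) / ‖1 - conj b * z‖) ^ 2 := by ring
    _ ≤ 8 * ((1 - s ^ 2) ^ (γ / 2) * (1 - ‖z‖) ^ (-(γ / 2)) * (1 - ‖b‖) ^ (-(γ / 2))) *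
          ((1 - ‖b‖) / ‖1 - conj b * z‖) ^ 2 := by gcongr
    _ = 8 * ((1 - s ^ 2) ^ (γ / 2) * (1 - ‖z‖) ^ (-(γ / 2))) *
          ((1 - ‖b‖) ^ 2 * forelliRudinKernel (γ / 2) b z) := by
        rw [forelliRudinKernel]
        ring

/-- The bound obtained for the ratio between the off-diagonal part of a row of the matrix
`kernelAtom γ (b k) (b j)` and its diagonal entry when `b` is `s`-separated. It tends to `0` as
`s → 1`. -/
noncomputable def offDiagonalConst (γ s : ℝ) : ℝ :=
  48 * forelliRudinConst (γ / 2) / s ^ 2 * (1 - s ^ 2) ^ (γ / 2)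

theorem exists_offDiagonalConst_lt_one (h0 : 0 < γ) :
    ∃ s ∈ Ioo (0 : ℝ) 1, offDiagonalConst γ s < 1 := by
  have hcont : ContinuousAt (offDiagonalConst γ) 1 := by
    unfold offDiagonalConst
    refine ContinuousAt.mul (by fun_prop (disch := norm_num)) ?_
    exact ContinuousAt.rpow_const (by fun_prop) (Or.inr (by positivity))
  have hone : offDiagonalConst γ 1 < 1 := by
    simp [offDiagonalConst, Real.zero_rpow (half_pos h0).ne']
  have hnear : ∀ᶠ s in 𝓝[<] 1, offDiagonalConst γ s < 1 :=
    (hcont.eventually_lt_const hone).filter_mono nhdsWithin_le_nhds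
  exact (Filter.Eventually.and (Ioo_mem_nhdsLT zero_lt_one) hnear).exists

/-- The superposition of the atoms `kernelAtom γ (b k)` with coefficients `e k`, used to interpolate
prescribed values at the points `b k`. -/
noncomputable def kernelSeries {ι : Type*} (γ : ℝ) (b e : ι → ℂ) (z : ℂ) : ℂ :=
  ∑' k, kernelAtom γ (b k) z * e k

namespace IsRhoSeparated

variable {ι : Type*} [Countable ι] {b : ι → ℂ} {e : ι → ℂ} {M : ℝ}

theorem summable_norm_kernelAtom (h : IsRhoSeparated s b) (hs0 : 0 < s) (hs : s ≤ 1) (h0 : 0 < γ)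
    (h1 : γ < 1) (hz : ‖z‖ < 1) : Summable fun k => ‖kernelAtom γ (b k) z‖ :=
  ((h.summable_and_tsum_forelliRudinKernel_le hs0 hs h0 h1 hz).1.mul_left 8).of_nonneg_of_le
    (fun _ => norm_nonneg _)
    fun k => norm_kernelAtom_le_forelliRudinKernel (h.norm_lt_one k) hz

theorem tsum_norm_kernelAtom_le (h : IsRhoSeparated s b) (hs0 : 0 < s) (hs : s ≤ 1) (h0 : 0 < γ)
    (h1 : γ < 1) (hz : ‖z‖ < 1) : ∑' k, ‖kernelAtom γ (b k) z‖ ≤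
      48 * forelliRudinConst γ / s ^ 2 * (1 - ‖z‖) ^ (-γ) := by
  obtain ⟨hsum, hle⟩ := h.summable_and_tsum_forelliRudinKernel_le hs0 hs h0 h1 hz
  calc ∑' k, ‖kernelAtom γ (b k) z‖
      ≤ ∑' k, 8 * ((1 - ‖b k‖) ^ 2 * forelliRudinKernel γ (b k) z) :=
        (h.summable_norm_kernelAtom hs0 hs h0 h1 hz).tsum_le_tsum
          (fun k => norm_kernelAtom_le_forelliRudinKernel (h.norm_lt_one k) hz) (hsum.mul_left 8)
    _ ≤ 8 * (6 * forelliRudinConst γ / s ^ 2 * (1 - ‖z‖) ^ (-γ)) := by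
        rw [tsum_mul_left]
        gcongr
    _ = 48 * forelliRudinConst γ / s ^ 2 * (1 - ‖z‖) ^ (-γ) := by ring

theorem summable_offDiagonal_norm_kernelAtom [DecidableEq ι] (h : IsRhoSeparated s b)
    (hs0 : 0 < s) (hs : s ≤ 1) (h0 : 0 < γ) (h1 : γ < 1) (j : ι) :
    Summable fun k => if k = j then 0 else ‖kernelAtom γ (b k) (b j)‖ := by
  refine (h.summable_norm_kernelAtom hs0 hs h0 h1 (h.norm_lt_one j)).of_nonneg_of_le
    (fun k => ?_) fun k => ?_ <;> split_ifs <;> simp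

theorem tsum_offDiagonal_norm_kernelAtom_le [DecidableEq ι] (h : IsRhoSeparated s b)
    (hs0 : 0 < s) (hs : s ≤ 1) (h0 : 0 < γ) (h1 : γ < 1) (j : ι) :
    ∑' k, (if k = j then 0 else ‖kernelAtom γ (b k) (b j)‖) ≤
      offDiagonalConst γ s * (1 - ‖b j‖) ^ (-γ) := by
  have hj := h.norm_lt_one j
  have hj' : 0 < 1 - ‖b j‖ := sub_pos.2 hj
  have hη : 0 ≤ 1 - s ^ 2 := by nlinarith
  obtain ⟨hsum, hle⟩ :=
    h.summable_and_tsum_forelliRudinKernel_le hs0 hs (half_pos h0) (by linarith) hj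
  set c := 8 * ((1 - s ^ 2) ^ (γ / 2) * (1 - ‖b j‖) ^ (-(γ / 2))) with hc
  have hc0 : 0 ≤ c := by positivity
  have hentry : ∀ k, (if k = j then 0 else ‖kernelAtom γ (b k) (b j)‖) ≤
      c * ((1 - ‖b k‖) ^ 2 * forelliRudinKernel (γ / 2) (b k) (b j)) := fun k => by
    split_ifs with hkj
    · exact mul_nonneg hc0
        (mul_nonneg (sq_nonneg _) (forelliRudinKernel_nonneg (h.norm_lt_one k) _))
    · exact norm_kernelAtom_le_of_le_rho (h.norm_lt_one k) hj hs0.le hs (h.le_rho k j hkj) h0.le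
        h1.le
  calc ∑' k, (if k = j then 0 else ‖kernelAtom γ (b k) (b j)‖)
      ≤ ∑' k, c * ((1 - ‖b k‖) ^ 2 * forelliRudinKernel (γ / 2) (b k) (b j)) :=
        (h.summable_offDiagonal_norm_kernelAtom hs0 hs h0 h1 j).tsum_le_tsum hentry
          (hsum.mul_left c)
    _ ≤ c * (6 * forelliRudinConst (γ / 2) / s ^ 2 * (1 - ‖b j‖) ^ (-(γ / 2))) := by
        rw [tsum_mul_left]
        gcongr
    _ = offDiagonalConst γ s * ((1 - ‖b j‖) ^ (-(γ / 2)) * (1 - ‖b j‖) ^ (-(γ / 2))) := by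
        rw [hc, offDiagonalConst]
        ring
    _ = offDiagonalConst γ s * (1 - ‖b j‖) ^ (-γ) := by
        rw [← Real.rpow_add hj', ← neg_add, add_halves]

theorem norm_kernelSeries_le (h : IsRhoSeparated s b) (hs0 : 0 < s) (hs : s ≤ 1) (h0 : 0 < γ)
    (h1 : γ < 1) (hM : 0 ≤ M) (he : ∀ k, ‖e k‖ ≤ M) (hz : ‖z‖ < 1) :
    ‖kernelSeries γ b e z‖ ≤ 48 * forelliRudinConst γ / s ^ 2 * M * (1 - ‖z‖) ^ (-γ) := by
  rw [mul_right_comm]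
  refine (norm_tsum_mul_le (h.summable_norm_kernelAtom hs0 hs h0 h1 hz) he).trans ?_
  gcongr
  exact h.tsum_norm_kernelAtom_le hs0 hs h0 h1 hz

theorem differentiableOn_kernelSeries (h : IsRhoSeparated s b) (hs0 : 0 < s) (hs : s ≤ 1)
    (h0 : 0 < γ) (h1 : γ < 1) (he : ∀ k, ‖e k‖ ≤ M) :
    DifferentiableOn ℂ (kernelSeries γ b e) disk := by
  intro z hz
  obtain ⟨r, hzr, hr⟩ := exists_between (mem_disk_iff.1 hz)
  have hsum : Summable fun k => (1 - ‖b k‖) ^ 2 * forelliRudinKernel γ (b k) 0 :=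
    (h.summable_and_tsum_forelliRudinKernel_le hs0 hs h0 h1 (by simp)).1
  have hterm : ∀ k, ∀ w ∈ ball (0 : ℂ) r, ‖kernelAtom γ (b k) w * e k‖ ≤
      8 * ((1 - r) ^ 2)⁻¹ * M * ((1 - ‖b k‖) ^ 2 * forelliRudinKernel γ (b k) 0) := by
    intro k w hw
    rw [mem_ball_zero_iff] at hw
    have hk := h.norm_lt_one k
    have hatom : ‖kernelAtom γ (b k) w‖ ≤
        8 * ((1 - ‖b k‖) ^ 2 * (((1 - r) ^ 2)⁻¹ * forelliRudinKernel γ (b k) 0)) := by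
      refine (norm_kernelAtom_le_forelliRudinKernel hk (hw.trans hr)).trans ?_
      gcongr
      exact forelliRudinKernel_le_of_norm_le hk hr hw.le
    calc ‖kernelAtom γ (b k) w * e k‖
        ≤ 8 * ((1 - ‖b k‖) ^ 2 * (((1 - r) ^ 2)⁻¹ * forelliRudinKernel γ (b k) 0)) * M := by
          rw [norm_mul]
          exact mul_le_mul hatom (he k) (norm_nonneg _) ((norm_nonneg _).trans hatom)
      _ = 8 * ((1 - r) ^ 2)⁻¹ * M * ((1 - ‖b k‖) ^ 2 * forelliRudinKernel γ (b k) 0) := by ring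
  have hdiff : DifferentiableOn ℂ (kernelSeries γ b e) (ball 0 r) :=
    Complex.differentiableOn_tsum_of_summable_norm (hsum.mul_left _)
      (fun k => ((differentiableOn_kernelAtom (h.norm_lt_one k)).mono
        (ball_subset_ball hr.le)).mul_const _) isOpen_ball hterm
  exact (hdiff.differentiableAt
    (isOpen_ball.mem_nhds (mem_ball_zero_iff.2 hzr))).differentiableWithinAt

theorem exists_kernelSeries_eq (h : IsRhoSeparated s b) (hs0 : 0 < s) (hs : s ≤ 1) (h0 : 0 < γ)
    (h1 : γ < 1) (hoff : offDiagonalConst γ s < 1) {v : ι → ℂ} (hv : ∀ k, ‖v k‖ ≤ M) :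
    ∃ e : ι → ℂ, (∃ M', ∀ k, ‖e k‖ ≤ M') ∧
      ∀ j, kernelSeries γ b e (b j) = ((1 - ‖b j‖) ^ (-γ) : ℝ) * v j := by
  classical
  have hweight : ∀ j, 0 < (1 - ‖b j‖) ^ (-γ) := fun j =>
    Real.rpow_pos_of_pos (sub_pos.2 (h.norm_lt_one j)) _
  have hweight' : ∀ j, (((1 - ‖b j‖) ^ (-γ) : ℝ) : ℂ) ≠ 0 := fun j =>
    Complex.ofReal_ne_zero.2 (hweight j).ne'
  let B : ι → ι → ℂ := fun j k =>
    (if k = j then 0 else kernelAtom γ (b k) (b j)) / ((1 - ‖b j‖) ^ (-γ) : ℝ)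
  have hnorm : ∀ j k, ‖B j k‖ =
      (if k = j then 0 else ‖kernelAtom γ (b k) (b j)‖) / (1 - ‖b j‖) ^ (-γ) := fun j k => by
    simp only [B, norm_div, Complex.norm_of_nonneg (hweight j).le, apply_ite norm, norm_zero]
  obtain ⟨e, ⟨M', he⟩, hsol⟩ := exists_bounded_add_tsum_mul_eq (B := B) hoff
    (fun j => by
      simp only [hnorm]
      exact (h.summable_offDiagonal_norm_kernelAtom hs0 hs h0 h1 j).div_const _)
    (fun j => by
      simp only [hnorm, tsum_div_const]
      exact (div_le_iff₀ (hweight j)).2 (h.tsum_offDiagonal_norm_kernelAtom_le hs0 hs h0 h1 j)) hv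
  refine ⟨e, ⟨M', he⟩, fun j => ?_⟩
  have hsum := (summable_norm_mul_of_norm_le
    (h.summable_norm_kernelAtom hs0 hs h0 h1 (h.norm_lt_one j)) he).of_norm
  rw [kernelSeries, hsum.tsum_eq_add_tsum_ite j, kernelAtom_self (h.norm_lt_one j), ← hsol j,
    mul_add, ← tsum_mul_left]
  congr 1
  refine tsum_congr fun k => ?_
  simp only [B]
  split_ifs
  · simp
  · rw [← mul_assoc, mul_div_cancel₀ _ (hweight' j)]

end IsRhoSeparated

end Interpolation

section NotReverseCarleson

theorem memBergman_of_norm_le_rpow {f : ℂ → ℂ} {γ M : ℝ} (hf : DifferentiableOn ℂ f disk)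
    (h0 : 0 < γ) (h1 : γ < 1 / 2) (hM : ∀ z, ‖z‖ < 1 → ‖f z‖ ≤ M * (1 - ‖z‖) ^ (-γ)) :
    MemBergman f := by
  refine memBergman_iff.2 ⟨hf, ?_⟩
  have hbound : ∀ z ∈ disk, ‖f z‖ₑ ^ 2 ≤
      ENNReal.ofReal (M ^ 2) * ENNReal.ofReal (forelliRudinKernel (2 * γ) z 0) := fun z hz => by
    have hz' : 0 ≤ 1 - ‖z‖ := (sub_pos.2 (mem_disk_iff.1 hz)).le
    rw [← ofReal_norm, ← ENNReal.ofReal_pow (norm_nonneg _), ← ENNReal.ofReal_mul (sq_nonneg _)]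
    refine ENNReal.ofReal_le_ofReal ?_
    calc ‖f z‖ ^ 2 ≤ (M * (1 - ‖z‖) ^ (-γ)) ^ 2 := by
          gcongr
          exact hM z (mem_disk_iff.1 hz)
      _ = M ^ 2 * forelliRudinKernel (2 * γ) z 0 := by
          rw [mul_pow, forelliRudinKernel_zero_right, ← Real.rpow_mul_natCast hz']
          congr 2
          push_cast
          ring
  calc ∫⁻ z in disk, ‖f z‖ₑ ^ 2
      ≤ ∫⁻ z in disk, ENNReal.ofReal (M ^ 2) *
          ENNReal.ofReal (forelliRudinKernel (2 * γ) z 0) :=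
        setLIntegral_mono' measurableSet_disk hbound
    _ = ENNReal.ofReal (M ^ 2) * ∫⁻ z in disk, ENNReal.ofReal (forelliRudinKernel (2 * γ) z 0) :=
        lintegral_const_mul' _ _ ENNReal.ofReal_ne_top
    _ < ∞ := ENNReal.mul_lt_top ENNReal.ofReal_lt_top <|
        (lintegral_forelliRudinKernel_le (by linarith) (by linarith) (by simp)).trans_lt
          ENNReal.ofReal_lt_top

theorem MemBergman.bounded_mul {f g : ℂ → ℂ} {M : ℝ} (hf : MemBergman f)
    (hg : DifferentiableOn ℂ g disk) (hM : ∀ z ∈ disk, ‖g z‖ ≤ M) :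
    MemBergman fun z => g z * f z := by
  rw [memBergman_iff] at hf ⊢
  refine ⟨hg.mul hf.1, ?_⟩
  calc ∫⁻ z in disk, ‖g z * f z‖ₑ ^ 2
      ≤ ∫⁻ z in disk, ENNReal.ofReal M ^ 2 * ‖f z‖ₑ ^ 2 := by
        refine setLIntegral_mono' measurableSet_disk fun z hz => ?_
        rw [enorm_mul, mul_pow, ← ofReal_norm (g z)]
        gcongr
        exact hM z hz
    _ = ENNReal.ofReal M ^ 2 * ∫⁻ z in disk, ‖f z‖ₑ ^ 2 := lintegral_const_mul' _ _ (by finiteness)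
    _ < ∞ := ENNReal.mul_lt_top (by finiteness) hf.2

theorem setLIntegral_area_enorm_sq_pos {f : ℂ → ℂ} (hf : DifferentiableOn ℂ f disk) {c : ℂ}
    (hc : c ∈ disk) (hfc : f c ≠ 0) : 0 < ∫⁻ z in disk, ‖f z‖ₑ ^ 2 ∂area := by
  have hc' : 0 < 1 - ‖c‖ := sub_pos.2 (mem_disk_iff.1 hc)
  have hsub : ball c (1 - ‖c‖) ⊆ disk := ball_subset_ball' (by simp)
  rw [setLIntegral_area]
  refine ENNReal.mul_pos (ENNReal.ofReal_pos.2 (by positivity)).ne' (ne_of_gt ?_)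
  calc 0 < volume (ball c (1 - ‖c‖)) * ‖f c ^ 2‖ₑ :=
        ENNReal.mul_pos (measure_ball_pos _ _ hc').ne' (by simpa using hfc)
    _ ≤ ∫⁻ z in ball c (1 - ‖c‖), ‖f z ^ 2‖ₑ := volume_ball_mul_enorm_le ((hf.mono hsub).pow 2)
    _ ≤ ∫⁻ z in disk, ‖f z‖ₑ ^ 2 := by
        simp only [enorm_pow]
        exact lintegral_mono_set hsub

theorem IsReverseCarleson.eq_zero_of_forall_eq_zero {b : ℕ → ℂ} (hb : ∀ k, b k ∈ disk)
    (h : IsReverseCarleson (pointMeasure b)) {f : ℂ → ℂ} (hf : MemBergman f)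
    (hfb : ∀ k, f (b k) = 0) {c : ℂ} (hc : c ∈ disk) : f c = 0 := by
  by_contra hfc
  obtain ⟨C, hC, hle⟩ := h
  have hvanish : ∫⁻ z in disk, ‖f z‖ₑ ^ 2 ∂pointMeasure b = 0 := by
    simp [setLIntegral_pointMeasure hb, hfb]
  refine ((ENNReal.mul_pos (ENNReal.ofReal_pos.2 hC).ne'
    (setLIntegral_area_enorm_sq_pos hf.1 hc hfc).ne').trans_le (hle f hf)).ne' hvanish

theorem IsRhoSeparated.not_isReverseCarleson_pointMeasure {γ s : ℝ} {b : ℕ → ℂ}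
    (h : IsRhoSeparated s b) (hs0 : 0 < s) (hs : s ≤ 1) (h0 : 0 < γ) (h1 : γ < 1 / 2)
    (hoff : offDiagonalConst γ s < 1) : ¬ IsReverseCarleson (pointMeasure b) := by
  intro hrev
  have hb : ∀ k, b k ∈ disk := fun k => mem_disk_iff.2 (h.norm_lt_one k)
  obtain ⟨e, ⟨M, he⟩, hinterp⟩ := h.exists_kernelSeries_eq hs0 hs h0 (by linarith) hoff
    (v := Pi.single 0 1) (M := 1) (fun k => by
      rcases eq_or_ne k 0 with rfl | hk <;> simp [*])
  have hM : 0 ≤ M := (norm_nonneg _).trans (he 0)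
  set f := kernelSeries γ b e
  have hf : MemBergman f :=
    memBergman_of_norm_le_rpow (h.differentiableOn_kernelSeries hs0 hs h0 (by linarith) he) h0 h1
      fun z hz => h.norm_kernelSeries_le hs0 hs h0 (by linarith) hM he hz
  have hg : MemBergman fun z => (z - b 0) * f z :=
    hf.bounded_mul (by fun_prop) (M := 1 + ‖b 0‖) fun z hz =>
      (norm_sub_le _ _).trans (by gcongr; exact (mem_disk_iff.1 hz).le)
  have hg_zero : ∀ z ∈ disk, (z - b 0) * f z = 0 := fun z hz =>
    hrev.eq_zero_of_forall_eq_zero hb hg (fun k => by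
      rcases eq_or_ne k 0 with rfl | hk
      · rw [sub_self, zero_mul]
      · rw [hinterp, Pi.single_eq_of_ne hk, mul_zero, mul_zero]) hz
  have hf_zero : ∀ᶠ z in 𝓝[≠] b 0, f z = 0 := by
    filter_upwards [mem_nhdsWithin_of_mem_nhds (isOpen_disk.mem_nhds (hb 0)), self_mem_nhdsWithin]
      with z hz hne
    exact (mul_eq_zero.1 (hg_zero z hz)).resolve_left (sub_ne_zero.2 hne)
  have hf_cont : ContinuousAt f (b 0) :=
    hf.1.continuousOn.continuousAt (isOpen_disk.mem_nhds (hb 0))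
  have hf0 : f (b 0) = 0 :=
    ((hf_cont.eventuallyEq_nhds_iff_eventuallyEq_nhdsNE continuousAt_const).1 hf_zero).self_of_nhds
  rw [hinterp 0, Pi.single_eq_same, mul_one, Complex.ofReal_eq_zero] at hf0
  exact (Real.rpow_pos_of_pos (sub_pos.2 (h.norm_lt_one 0)) _).ne' hf0

end NotReverseCarleson

section BergmanMetric

variable {δ : ℝ} {b : ℕ → ℂ}

theorem isFiniteMeasure_pointMeasure_of_le_beta (hδ : 0 < δ) (hb : ∀ k, b k ∈ disk)
    (hsep : ∀ k j, k ≠ j → δ ≤ beta (b k) (b j)) : IsFiniteMeasure (pointMeasure b) := by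
  have htanh : Real.tanh δ ∈ Ioo (-1 : ℝ) 1 := ⟨Real.neg_one_lt_tanh δ, Real.tanh_lt_one δ⟩
  have htanh_pos : 0 < Real.tanh δ := by
    rw [Real.tanh_eq_sinh_div_cosh]
    exact div_pos (Real.sinh_pos_iff.2 hδ) (Real.cosh_pos δ)
  have hsep' : IsRhoSeparated (Real.tanh δ) b :=
    isRhoSeparated_of_artanh_le_beta htanh hb (by simpa only [Real.artanh_tanh] using hsep)
  exact hsep'.isFiniteMeasure_pointMeasure htanh_pos htanh.2.le

theorem isReverseCarleson_pointMeasure_of_disk_subset (hb : ∀ k, b k ∈ disk)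
    (hcover : disk ⊆ ⋃ k, bergmanDisk (b k) (Real.artanh (1 / 193))) :
    IsReverseCarleson (pointMeasure b) := by
  refine isReverseCarleson_pointMeasure_of_rho_lt hb fun z hz => ?_
  obtain ⟨k, hk⟩ := mem_iUnion.1 (hcover hz)
  exact ⟨k, rho_lt_of_beta_lt_artanh (mem_disk_iff.1 (hb k)) (mem_disk_iff.1 hz)
    ⟨by norm_num, by norm_num⟩ hk.2⟩

theorem exists_forall_le_beta_not_isReverseCarleson :
    ∃ δ > 0, ∀ b : ℕ → ℂ, (∀ k, b k ∈ disk) → (∀ k j, k ≠ j → δ ≤ beta (b k) (b j)) →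
      ¬ IsReverseCarleson (pointMeasure b) := by
  obtain ⟨s, ⟨hs0, hs1⟩, hoff⟩ := exists_offDiagonalConst_lt_one (γ := 1 / 4) (by norm_num)
  refine ⟨Real.artanh s, Real.artanh_pos ⟨hs0, hs1⟩, fun b hb hsep => ?_⟩
  exact (isRhoSeparated_of_artanh_le_beta ⟨by linarith, hs1⟩ hb hsep
    ).not_isReverseCarleson_pointMeasure hs0 hs1.le (by norm_num) (by norm_num) hoff

end BergmanMetric

theorem mainTheorem8_general :
    (∀ (δ : ℝ) (b : ℕ → ℂ), 0 < δ → (∀ k, b k ∈ disk) →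
      (∀ k j, k ≠ j → δ ≤ beta (b k) (b j)) → IsFiniteMeasure (pointMeasure b)) ∧
    (∃ R₀ > 0, ∀ b : ℕ → ℂ, (∀ k, b k ∈ disk) → disk ⊆ ⋃ k, bergmanDisk (b k) R₀ →
      IsReverseCarleson (pointMeasure b)) ∧
    (∃ δ > 0, ∀ b : ℕ → ℂ, (∀ k, b k ∈ disk) → (∀ k j, k ≠ j → δ ≤ beta (b k) (b j)) →
      ¬ IsReverseCarleson (pointMeasure b)) :=
  ⟨fun _ _ => isFiniteMeasure_pointMeasure_of_le_beta,
    ⟨Real.artanh (1 / 193), Real.artanh_pos ⟨by norm_num, by norm_num⟩,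
      fun _ => isReverseCarleson_pointMeasure_of_disk_subset⟩,
    exists_forall_le_beta_not_isReverseCarleson⟩

end Bergman

theorem mainTheorem8 :
    (∀ (R : ℝ) (b : ℕ → ℂ), 0 < R → Bergman.IsLattice R b →
      IsFiniteMeasure (Bergman.pointMeasure b)) ∧
    (∃ R₀ : ℝ, 0 < R₀ ∧ ∀ (R : ℝ) (b : ℕ → ℂ), 0 < R → R < R₀ → Bergman.IsLattice R b →
      Bergman.IsReverseCarleson (Bergman.pointMeasure b)) ∧
    (∃ R₁ : ℝ, 0 < R₁ ∧ ∀ (R : ℝ) (b : ℕ → ℂ), R₁ < R → Bergman.IsLattice R b →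
      ¬ Bergman.IsReverseCarleson (Bergman.pointMeasure b)) := by
  obtain ⟨hfinite, ⟨R₀, hR₀, hdense⟩, δ, hδ, hsparse⟩ := Bergman.mainTheorem8_general
  refine ⟨fun R b hR h => hfinite _ b (half_pos hR) h.mem_disk h.separated,
    ⟨R₀, hR₀, fun R b _ hR h => hdense b h.mem_disk (h.cover.subset.trans
      (iUnion_mono fun k z hz => ⟨hz.1, hz.2.trans hR⟩))⟩,
    ⟨2 * δ, by positivity, fun R b hR h => hsparse b h.mem_disk fun k j hkj =>
      le_trans (by linarith) (h.separated k j hkj)⟩⟩
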